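/- Let $k\ge 1$ and let $\alpha=(\alpha_1,\dots,\alpha_r)$ be a (possibly empty) sequence of integers with $1\le\alpha_i\le k$ for all $i$ and $\alpha_1+\cdots+\alpha_r=n$, where $k\le n+1$. Write $\mathbf x_n=(x_1,\dots,x_n)$, let $e_d$ and $h_d$ be the elementary and complete homogeneous symmetric polynomials, and let the $i$-th batch of variables be $\mathbf x_n^{(i)}=(x_{\alpha_1+\cdots+\alpha_{i-1}+1},\dots,x_{\alpha_1+\cdots+\alpha_{i-1}+\alpha_i})$. Let $I_{\alpha,k}\subseteq\mathbb Z[\mathbf x_n]$ be the ideal generated by $e_d(\mathbf x_n)$ for $n-k+1\le d\le n$ and by $h_d(\mathbf x_n^{(i)})$ for $1\le i\le r$ and $k-\alpha_i+1\le d\le k$, and let $J_{\alpha,k}\subseteq\mathbb Q[\mathbf x_n]$ be the ideal with the same generators. The term order $\mathtt{neglex}$ is defined by $x_1^{a_1}\cdots x_n^{a_n}<x_1^{b_1}\cdots x_n^{b_n}$ if there is an index $i$ with $a_i<b_i$ and $a_j=b_j$ for all $j>i$. A Gröbner basis of an ideal $J\subseteq\mathbb Q[\mathbf x_n]$ is a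 finite subset $G\subseteq J$ such that the leading monomials of the nonzero elements of $G$ generate the ideal generated by the leading monomials of all nonzero elements of $J$. For a weak composition $\gamma=(\gamma_1,\dots,\gamma_n)$ of nonnegative integers, the Demazure character $\kappa_\gamma(\mathbf x_n)$ is defined recursively: $\kappa_\gamma=x_1^{\gamma_1}\cdots x_n^{\gamma_n}$ if $\gamma_1\ge\cdots\ge\gamma_n$; and if $\gamma_i<\gamma_{i+1}$ then $\kappa_\gamma=\pi_i(\kappa_{\gamma'})$, where $\gamma'$ is obtained from $\gamma$ by exchanging $\gamma_i$ and $\gamma_{i+1}$ and $\pi_i(f)=\dfrac{x_if-x_{i+1}\,s_i(f)}{x_i-x_{i+1}}$, with $s_i(f)$ obtained from $f$ by exchanging $x_i$ and $x_{i+1}$. For $S=\{s_1<\cdots<s_t\}\subseteq[n]$ let $\gamma(S)=(\gamma_1,\dots,\gamma_n)$ with $\gamma_i=i-j+1$ if $i=s_j\in S$ and $\gamma_i=0$ if $i\notin S$, and let $\gamma(S)^*=(\gamma_n,\dots,\gamma_1)$. Then, with respect to $\mathtt{neglex}$, the Demazure characters $$\kappa_{\gamma(S)^*}(\mathbf x_n),\qquad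 S\subseteq[n],\ |S|=n-k+1,$$ together with the polynomials $$h_{k-j+1}(x_{\alpha_1+\cdots+\alpha_{i-1}+1},\dots,x_{\alpha_1+\cdots+\alpha_{i-1}+j}),\qquad 1\le i\le r,\ 1\le j\le\alpha_i,$$ form a Gröbner basis of $J_{\alpha,k}$. Moreover, every one of these polynomials has integer coefficients and $\mathtt{neglex}$-leading coefficient $1$, and lies in $I_{\alpha,k}\subseteq\mathbb Z[\mathbf x_n]$. -/

import Mathlib

noncomputable section

namespace SpanningConfig

open MvPolynomial

/-! ### The term order `neglex` and Groebner bases -/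

/-- The `neglex` term order on monomials in `x_1, ..., x_n`: `a < b` when there is an index `i` with
`a i < b i` and `a j = b j` for all `j > i`. -/
def neglex (n : ℕ) : MonomialOrder (Fin n) where
  syn := Colex (Fin n →₀ ℕ)
  isOrderedAddMonoid_syn :=
    { add_le_add_left := fun a b h c => by
        rcases h.lt_or_eq with h | h
        · obtain ⟨i, h1, h2⟩ := Finsupp.Colex.lt_iff.1 h
          refine le_of_lt (Finsupp.Colex.lt_iff.2 ⟨i, fun j hj => ?_, ?_⟩)
          · exact congrArg (· + ofColex c j) (h1 j hj)
          · exact Nat.add_lt_add_right h2 (ofColex c i)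
        · rw [h] }
  toSyn :=
  { toEquiv := toColex
    map_add' := fun _ _ => rfl }
  toSyn_monotone := Finsupp.toColex_monotone

open scoped MonomialOrder in
theorem neglex_lt_iff {n : ℕ} (a b : Fin n →₀ ℕ) :
    a ≺[neglex n] b ↔ ∃ i, a i < b i ∧ ∀ j, i < j → a j = b j := by
  refine Finsupp.Colex.lt_iff.trans ?_
  simp only [and_comm]
  rfl

/-- The leading monomial `in_<(f)` (with coefficient `1`) of a nonzero polynomial `f`. -/
def initialMonomial {σ R : Type*} [CommSemiring R] (m : MonomialOrder σ) (f : MvPolynomial σ R) :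
    MvPolynomial σ R :=
  monomial (m.degree f) 1

/-- The ideal generated by the leading monomials of the nonzero elements of a set of polynomials. -/
def initialIdeal {σ R : Type*} [CommSemiring R] (m : MonomialOrder σ) (F : Set (MvPolynomial σ R)) :
    Ideal (MvPolynomial σ R) :=
  Ideal.span {p | ∃ f ∈ F, f ≠ 0 ∧ p = initialMonomial m f}

/-- `G` is a Groebner basis of the ideal `J`: a finite subset of `J` whose leading monomials
generate the initial ideal of `J`. -/
def IsGroebnerBasis {σ K : Type*} [Field K] (m : MonomialOrder σ)
    (J : Ideal (MvPolynomial σ K)) (G : Set (MvPolynomial σ K)) : Prop :=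
  G.Finite ∧ G ⊆ (J : Set (MvPolynomial σ K)) ∧
    initialIdeal m (J : Set (MvPolynomial σ K)) = initialIdeal m G

/-! ### Divided differences and Demazure characters -/

section Demazure

variable {σ R : Type*} [DecidableEq σ] [CommRing R]

/-- Exchange of the variables `x_i` and `x_j`. -/
def swapVars (i j : σ) : MvPolynomial σ R →ₐ[R] MvPolynomial σ R :=
  rename (Equiv.swap i j)

theorem X_sub_X_dvd_sub_swapVars (i j : σ) (f : MvPolynomial σ R) :
    (X i - X j : MvPolynomial σ R) ∣ f - swapVars i j f := by
  rw [← Ideal.mem_span_singleton, ← Ideal.Quotient.eq_zero_iff_mem, map_sub, sub_eq_zero]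
  set I : Ideal (MvPolynomial σ R) := Ideal.span {X i - X j}
  have hX : (Ideal.Quotient.mkₐ R I) (X i) = (Ideal.Quotient.mkₐ R I) (X j) := by
    rw [← sub_eq_zero, ← map_sub]
    exact Ideal.Quotient.eq_zero_iff_mem.2 (Ideal.subset_span rfl)
  have h : Ideal.Quotient.mkₐ R I = (Ideal.Quotient.mkₐ R I).comp (swapVars i j) := by
    apply MvPolynomial.algHom_ext
    intro l
    simp only [AlgHom.comp_apply, swapVars, rename_X]
    rcases eq_or_ne l i with rfl | hi
    · rw [Equiv.swap_apply_left, hX]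
    rcases eq_or_ne l j with rfl | hj
    · rw [Equiv.swap_apply_right, hX]
    rw [Equiv.swap_apply_of_ne_of_ne hi hj]
  exact DFunLike.congr_fun h f

/-- The divided difference `(f - s f) / (x_i - x_j)`, where `s` exchanges `x_i` and `x_j`
(used for `i ≠ j`, where the exact quotient is unique). -/
def dividedDiff (i j : σ) (f : MvPolynomial σ R) : MvPolynomial σ R :=
  (X_sub_X_dvd_sub_swapVars i j f).choose

theorem mul_dividedDiff (i j : σ) (f : MvPolynomial σ R) :
    (X i - X j) * dividedDiff i j f = f - swapVars i j f :=
  (X_sub_X_dvd_sub_swapVars i j f).choose_spec.symm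

/-- The isobaric divided difference `π f = ∂ (x_i f)`. -/
def isobaric (i j : σ) (f : MvPolynomial σ R) : MvPolynomial σ R :=
  dividedDiff i j (X i * f)

theorem mul_isobaric (i j : σ) (f : MvPolynomial σ R) :
    (X i - X j) * isobaric i j f = X i * f - X j * swapVars i j f := by
  simp [isobaric, mul_dividedDiff, swapVars]

theorem swapVars_X (i j l : σ) : swapVars i j (X l : MvPolynomial σ R) = X (Equiv.swap i j l) := by
  simp [swapVars]

theorem swapVars_mul_isobaric (s t : σ) (i j : σ) (f : MvPolynomial σ R) :
    (X (Equiv.swap s t i) - X (Equiv.swap s t j)) * swapVars s t (isobaric i j f) =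
      X (Equiv.swap s t i) * swapVars s t f -
        X (Equiv.swap s t j) * swapVars s t (swapVars i j f) := by
  have h := congrArg (swapVars s t) (mul_isobaric i j f)
  simpa only [map_mul, map_sub, swapVars_X] using h

theorem X_sub_X_ne_zero {σ R : Type*} [CommRing R] [Nontrivial R] {i j : σ} (h : i ≠ j) :
    (X i - X j : MvPolynomial σ R) ≠ 0 :=
  sub_ne_zero.2 fun e => h (X_injective e)

theorem isobaric_comm [IsDomain R] {i j k l : σ} (hij : i ≠ j) (hkl : k ≠ l) (hik : i ≠ k)
    (hil : i ≠ l) (hjk : j ≠ k) (hjl : j ≠ l) (f : MvPolynomial σ R) :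
    isobaric i j (isobaric k l f) = isobaric k l (isobaric i j f) := by
  have h1 := mul_isobaric i j (isobaric k l f)
  have h2 := mul_isobaric k l (isobaric i j f)
  have h3 := swapVars_mul_isobaric i j k l f
  have h4 := swapVars_mul_isobaric k l i j f
  rw [Equiv.swap_apply_of_ne_of_ne hik.symm hjk.symm,
    Equiv.swap_apply_of_ne_of_ne hil.symm hjl.symm] at h3
  rw [Equiv.swap_apply_of_ne_of_ne hik hil, Equiv.swap_apply_of_ne_of_ne hjk hjl] at h4
  have h5 := mul_isobaric i j f
  have h6 := mul_isobaric k l f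
  have h7 : swapVars i j (swapVars k l f) = swapVars k l (swapVars i j f) := by
    simp only [swapVars, rename_rename]
    congr 2
    rw [← Equiv.Perm.coe_mul, ← Equiv.Perm.coe_mul]
    refine congrArg _ (Equiv.Perm.Disjoint.commute ?_).eq
    intro a
    by_cases h : a = i ∨ a = j
    · right
      rcases h with rfl | rfl <;> apply Equiv.swap_apply_of_ne_of_ne <;> assumption
    · left
      push Not at h
      exact Equiv.swap_apply_of_ne_of_ne h.1 h.2
  apply mul_left_cancel₀ (mul_ne_zero (X_sub_X_ne_zero (R := R) hij) (X_sub_X_ne_zero (R := R) hkl))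
  linear_combination (X k - X l) * h1 - (X i - X j) * h2 - X j * h3 + X l * h4 + X i * h6 -
    X k * h5 + X j * X l * h7

theorem isobaric_braid [IsDomain R] {i j k : σ} (hij : i ≠ j) (hjk : j ≠ k) (hik : i ≠ k)
    (f : MvPolynomial σ R) :
    isobaric i j (isobaric j k (isobaric i j f)) =
      isobaric j k (isobaric i j (isobaric j k f)) := by
  have e1 : Equiv.swap i j i = j := Equiv.swap_apply_left _ _
  have e2 : Equiv.swap i j j = i := Equiv.swap_apply_right _ _
  have e3 : Equiv.swap i j k = k := Equiv.swap_apply_of_ne_of_ne hik.symm hjk.symm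
  have e4 : Equiv.swap j k j = k := Equiv.swap_apply_left _ _
  have e5 : Equiv.swap j k k = j := Equiv.swap_apply_right _ _
  have e6 : Equiv.swap j k i = i := Equiv.swap_apply_of_ne_of_ne hij hik
  have invol : ∀ (a b : σ) (g : MvPolynomial σ R), swapVars a b (swapVars a b g) = g := by
    intro a b g
    simp [swapVars, rename_rename, ← Equiv.Perm.coe_mul]
  have br : swapVars i j (swapVars j k (swapVars i j f)) =
      swapVars j k (swapVars i j (swapVars j k f)) := by
    simp only [swapVars, rename_rename]
    congr 2
    simp only [← Equiv.Perm.coe_mul]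
    refine congrArg _ ?_
    rw [← mul_assoc, ← mul_assoc, Equiv.swap_mul_swap_mul_swap hij hik,
      Equiv.swap_comm j k, Equiv.swap_comm i j, Equiv.swap_mul_swap_mul_swap hjk.symm hik.symm,
      Equiv.swap_comm]
  set u := isobaric i j f with hu
  set v := isobaric j k u with hv
  set u' := isobaric j k f with hu'
  set v' := isobaric i j u' with hv'
  have a1 := mul_isobaric i j v
  have a2 := mul_isobaric j k u
  have a3 := swapVars_mul_isobaric i j j k u
  have a4 := mul_isobaric i j f
  have a5 := swapVars_mul_isobaric j k i j f
  have a6 := swapVars_mul_isobaric i j i j f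
  have a7 := congrArg (swapVars i j) a5
  have b1 := mul_isobaric j k v'
  have b2 := mul_isobaric i j u'
  have b3 := swapVars_mul_isobaric j k i j u'
  have b4 := mul_isobaric j k f
  have b5 := swapVars_mul_isobaric i j j k f
  have b6 := swapVars_mul_isobaric j k j k f
  have b7 := congrArg (swapVars j k) b5
  simp only [map_mul, map_sub, swapVars_X, invol, e1, e2, e3, e4, e5, e6, ← hu, ← hv, ← hu',
    ← hv'] at a1 a2 a3 a4 a5 a6 a7 b1 b2 b3 b4 b5 b6 b7
  have su : swapVars i j u = u := by
    apply mul_left_cancel₀ (X_sub_X_ne_zero (R := R) hij)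
    linear_combination -a6 - a4
  have su' : swapVars j k u' = u' := by
    apply mul_left_cancel₀ (X_sub_X_ne_zero (R := R) hjk)
    linear_combination -b6 - b4
  rw [su] at a3
  rw [su'] at b3
  apply mul_left_cancel₀ (mul_ne_zero (mul_ne_zero (X_sub_X_ne_zero (R := R) hij)
    (X_sub_X_ne_zero (R := R) hik)) (X_sub_X_ne_zero (R := R) hjk))
  linear_combination (X i - X k) * (X j - X k) * a1 + X i * (X i - X k) * a2 -
    X j * (X j - X k) * a3 + X i * X j * a4 - X i * X k * a5 + X j * X k * a7 -
    ((X i - X j) * (X i - X k) * b1 + X j * (X i - X k) * b2 - X k * (X i - X j) * b3 +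
      X i ^ 2 * b4 - X j ^ 2 * b5 + X k ^ 2 * b7) - X j * X k ^ 2 * br

end Demazure

theorem sum_swap_lt {n : ℕ} (γ : Fin n → ℕ) (p : Fin n × Fin n)
    (hp : (p.1 : ℕ) + 1 = p.2 ∧ γ p.1 < γ p.2) :
    ∑ a : Fin n, (a : ℕ) * (γ ∘ Equiv.swap p.1 p.2) a < ∑ a : Fin n, (a : ℕ) * γ a := by
  obtain ⟨i, j⟩ := p
  obtain ⟨h1, h2⟩ := hp
  simp only at h1 h2
  have hij : i ≠ j := by rintro rfl; omega
  have key : ∀ f : Fin n → ℕ, ∑ a, f a = f i + f j + ∑ a ∈ (Finset.univ.erase i).erase j, f a := by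
    intro f
    rw [add_assoc, Finset.add_sum_erase _ _ (by simp [hij.symm]),
      Finset.add_sum_erase _ _ (Finset.mem_univ _)]
  rw [key, key]
  refine Nat.add_lt_add_of_lt_of_le ?_ (Finset.sum_le_sum fun a ha => ?_)
  · simp only [Function.comp, Equiv.swap_apply_left, Equiv.swap_apply_right, ← h1]
    nlinarith
  · simp only [Finset.mem_erase] at ha
    simp [Equiv.swap_apply_of_ne_of_ne ha.2.1 ha.1]

/-- The Demazure character (key polynomial) of a weak composition `γ` of length `n`: it is
`x ^ γ` if `γ` is weakly decreasing; otherwise it is `π_i κ_{s_i γ}` for an ascent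
`γ_i < γ_{i+1}`, where `s_i γ` exchanges the entries in positions `i, i + 1`
(any ascent may be used, see `demazure_of_ascent`). -/
def demazure (R : Type*) [CommRing R] {n : ℕ} (γ : Fin n → ℕ) : MvPolynomial (Fin n) R :=
  open Classical in
  if h : ∃ p : Fin n × Fin n, (p.1 : ℕ) + 1 = p.2 ∧ γ p.1 < γ p.2 then
    isobaric h.choose.1 h.choose.2 (demazure R (γ ∘ Equiv.swap h.choose.1 h.choose.2))
  else
    ∏ a, X a ^ γ a
termination_by ∑ a : Fin n, (a : ℕ) * γ a
decreasing_by exact sum_swap_lt γ _ h.choose_spec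

theorem demazure_of_antitone {R : Type*} [CommRing R] {n : ℕ} {γ : Fin n → ℕ} (h : Antitone γ) :
    demazure R γ = ∏ a, X a ^ γ a := by
  rw [demazure, dif_neg]
  rintro ⟨p, h1, h2⟩
  exact absurd (h (show p.1 ≤ p.2 from Fin.le_def.2 (by omega))) (not_le.2 h2)

theorem demazure_confluent {R : Type*} [CommRing R] [IsDomain R] {n : ℕ} {γ : Fin n → ℕ}
    (ih : ∀ δ : Fin n → ℕ, ∑ a : Fin n, (a : ℕ) * δ a < ∑ a : Fin n, (a : ℕ) * γ a →
      ∀ i j : Fin n, (i : ℕ) + 1 = j → δ i < δ j →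
        demazure R δ = isobaric i j (demazure R (δ ∘ Equiv.swap i j)))
    {i j k l : Fin n} (hij : (i : ℕ) + 1 = j) (hγ : γ i < γ j) (hkl : (k : ℕ) + 1 = l)
    (hγ' : γ k < γ l) (hlt : i < k) :
    isobaric i j (demazure R (γ ∘ Equiv.swap i j)) =
      isobaric k l (demazure R (γ ∘ Equiv.swap k l)) := by
  have hik : i ≠ k := hlt.ne
  have hij' : i ≠ j := by rintro rfl; omega
  have hkl' : k ≠ l := by rintro rfl; omega
  have hil : i ≠ l := by rintro rfl; rw [Fin.lt_def] at hlt; omega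
  have hjl : j ≠ l := by rintro rfl; rw [Fin.lt_def] at hlt; omega
  have m1 := sum_swap_lt γ (i, j) ⟨hij, hγ⟩
  have m2 := sum_swap_lt γ (k, l) ⟨hkl, hγ'⟩
  simp only at m1 m2
  by_cases hjk : j = k
  · subst hjk
    have e1 : Equiv.swap i j i = j := Equiv.swap_apply_left _ _
    have e2 : Equiv.swap i j j = i := Equiv.swap_apply_right _ _
    have e3 : Equiv.swap i j l = l := Equiv.swap_apply_of_ne_of_ne hil.symm hjl.symm
    have e4 : Equiv.swap j l j = l := Equiv.swap_apply_left _ _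
    have e5 : Equiv.swap j l l = j := Equiv.swap_apply_right _ _
    have e6 : Equiv.swap j l i = i := Equiv.swap_apply_of_ne_of_ne hij' hil
    have a1 : (γ ∘ Equiv.swap i j) j < (γ ∘ Equiv.swap i j) l := by
      simp only [Function.comp, e2, e3]; omega
    have a2 : ((γ ∘ Equiv.swap i j) ∘ Equiv.swap j l) i <
        ((γ ∘ Equiv.swap i j) ∘ Equiv.swap j l) j := by
      simp only [Function.comp, e6, e4, e1, e3]; omega
    have a3 : (γ ∘ Equiv.swap j l) i < (γ ∘ Equiv.swap j l) j := by
      simp only [Function.comp, e4, e6]; omega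
    have a4 : ((γ ∘ Equiv.swap j l) ∘ Equiv.swap i j) j <
        ((γ ∘ Equiv.swap j l) ∘ Equiv.swap i j) l := by
      simp only [Function.comp, e2, e3, e6, e5]; omega
    have m3 := sum_swap_lt _ (j, l) ⟨hkl, a1⟩
    have m4 := sum_swap_lt _ (i, j) ⟨hij, a3⟩
    simp only at m3 m4
    rw [ih _ m1 j l hkl a1, ih _ (m3.trans m1) i j hij a2, ih _ m2 i j hij a3,
      ih _ (m4.trans m2) j l hkl a4, isobaric_braid hij' hjl hil]
    have br : ((γ ∘ Equiv.swap i j) ∘ Equiv.swap j l) ∘ Equiv.swap i j =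
        ((γ ∘ Equiv.swap j l) ∘ Equiv.swap i j) ∘ Equiv.swap j l := by
      simp only [Function.comp_assoc, ← Equiv.Perm.coe_mul]
      rw [Equiv.swap_mul_swap_mul_swap hij' hil,
        Equiv.swap_comm j l, Equiv.swap_comm i j,
        Equiv.swap_mul_swap_mul_swap hjl.symm hil.symm, Equiv.swap_comm]
    rw [br]
  · have e1 : Equiv.swap i j k = k := Equiv.swap_apply_of_ne_of_ne hik.symm (Ne.symm hjk)
    have e2 : Equiv.swap i j l = l := Equiv.swap_apply_of_ne_of_ne hil.symm hjl.symm
    have e3 : Equiv.swap k l i = i := Equiv.swap_apply_of_ne_of_ne hik hil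
    have e4 : Equiv.swap k l j = j := Equiv.swap_apply_of_ne_of_ne hjk hjl
    have a1 : (γ ∘ Equiv.swap i j) k < (γ ∘ Equiv.swap i j) l := by
      simpa only [Function.comp, e1, e2] using hγ'
    have a2 : (γ ∘ Equiv.swap k l) i < (γ ∘ Equiv.swap k l) j := by
      simpa only [Function.comp, e3, e4] using hγ
    rw [ih _ m1 k l hkl a1, ih _ m2 i j hij a2, isobaric_comm hij' hkl' hik hil hjk hjl]
    have cm : (γ ∘ Equiv.swap i j) ∘ Equiv.swap k l = (γ ∘ Equiv.swap k l) ∘ Equiv.swap i j := by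
      simp only [Function.comp_assoc, ← Equiv.Perm.coe_mul]
      refine congrArg (fun e : Equiv.Perm (Fin n) => γ ∘ e) (Equiv.Perm.Disjoint.commute ?_).eq
      intro a
      by_cases h : a = i ∨ a = j
      · right
        rcases h with rfl | rfl <;> assumption
      · left
        push Not at h
        exact Equiv.swap_apply_of_ne_of_ne h.1 h.2
    rw [cm]

/-- The recursion of Demazure characters holds at every ascent `γ_i < γ_{i+1}`; in particular
`demazure` does not depend on the ascents used to compute it. -/
theorem demazure_of_ascent {R : Type*} [CommRing R] [IsDomain R] {n : ℕ} (γ : Fin n → ℕ)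
    (i j : Fin n) (hij : (i : ℕ) + 1 = j) (hγ : γ i < γ j) :
    demazure R γ = isobaric i j (demazure R (γ ∘ Equiv.swap i j)) := by
  induction hN : ∑ a : Fin n, (a : ℕ) * γ a using Nat.strong_induction_on generalizing γ i j with
  | _ N ih =>
    subst hN
    have ih' : ∀ δ : Fin n → ℕ, ∑ a : Fin n, (a : ℕ) * δ a < ∑ a : Fin n, (a : ℕ) * γ a →
        ∀ i j : Fin n, (i : ℕ) + 1 = j → δ i < δ j →
          demazure R δ = isobaric i j (demazure R (δ ∘ Equiv.swap i j)) :=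
      fun δ hδ i j hij hδ' => ih _ hδ δ i j hij hδ' rfl
    have h : ∃ p : Fin n × Fin n, (p.1 : ℕ) + 1 = p.2 ∧ γ p.1 < γ p.2 := ⟨(i, j), hij, hγ⟩
    have h0 : demazure R γ =
        isobaric h.choose.1 h.choose.2 (demazure R (γ ∘ Equiv.swap h.choose.1 h.choose.2)) := by
      conv_lhs => rw [demazure, dif_pos h]
    rw [h0]
    obtain ⟨c1, c2⟩ := h.choose_spec
    generalize h.choose = q at c1 c2 h0 ⊢
    obtain ⟨k, l⟩ := q
    simp only at c1 c2
    rcases lt_trichotomy i k with hlt | rfl | hlt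
    · exact (demazure_confluent ih' hij hγ c1 c2 hlt).symm
    · obtain rfl : l = j := Fin.ext (by omega)
      rfl
    · exact demazure_confluent ih' c1 c2 hij hγ hlt

/-! ### Skip sequences, batches of variables, and the ideals -/

/-- The skip sequence `γ(S)`: if `i` (counted from `1`) is the `j`-th smallest element of `S` then
the `i`-th entry is `i - j + 1`; the entries outside `S` are `0`. -/
def skipSeq {n : ℕ} (S : Finset (Fin n)) (i : Fin n) : ℕ :=
  if i ∈ S then ((i : ℕ) + 1) - (S.filter (· ≤ i)).card + 1 else 0

/-- The reverse skip sequence `γ(S)^* = (γ_n, ..., γ_1)`. -/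
def revSkipSeq {n : ℕ} (S : Finset (Fin n)) (i : Fin n) : ℕ :=
  skipSeq S i.rev

/-- The first `j` variables of the `i`-th batch: (zero-based) positions `p` with
`α_1 + ... + α_{i-1} ≤ p < α_1 + ... + α_{i-1} + j`. -/
def batchInit {r : ℕ} (n : ℕ) (α : Fin r → ℕ) (i : Fin r) (j : ℕ) : Finset (Fin n) :=
  Finset.univ.filter fun p =>
    ∑ t ∈ Finset.univ.filter (· < i), α t ≤ (p : ℕ) ∧
      (p : ℕ) < ∑ t ∈ Finset.univ.filter (· < i), α t + j

/-- The complete homogeneous symmetric polynomial `h_d` in the variables indexed by `A`. -/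
def hsymmOn (R : Type*) [CommRing R] {n : ℕ} (A : Finset (Fin n)) (d : ℕ) :
    MvPolynomial (Fin n) R :=
  rename (Subtype.val : A → Fin n) (hsymm A R d)

/-- The ideal of `R[x_1, ..., x_n]` generated by `e_d(x_1, ..., x_n)` for `n - k + 1 ≤ d ≤ n` and by
`h_d` of the `i`-th batch for `k - α_i + 1 ≤ d ≤ k`. For `R = ℤ` it is `I_{α,k}`; for `R = ℚ` it is
`J_{α,k}`. -/
def configIdeal (R : Type*) [CommRing R] {r : ℕ} (n : ℕ) (α : Fin r → ℕ) (k : ℕ) :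
    Ideal (MvPolynomial (Fin n) R) :=
  Ideal.span
    ({f | ∃ d, n + 1 ≤ d + k ∧ d ≤ n ∧ f = esymm (Fin n) R d} ∪
      {f | ∃ (i : Fin r) (d : ℕ), k + 1 ≤ d + α i ∧ d ≤ k ∧
        f = hsymmOn R (batchInit n α i (α i)) d})

/-- The Demazure characters `κ_{γ(S)^*}` for `|S| = n - k + 1`, together with the polynomials
`h_{k-j+1}` in the first `j` variables of the `i`-th batch for `1 ≤ j ≤ α_i`. -/
def groebnerSet (R : Type*) [CommRing R] {r : ℕ} (n : ℕ) (α : Fin r → ℕ) (k : ℕ) :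
    Set (MvPolynomial (Fin n) R) :=
  {f | ∃ S : Finset (Fin n), S.card + k = n + 1 ∧ f = demazure R (revSkipSeq S)} ∪
    {f | ∃ (i : Fin r) (j : ℕ), 1 ≤ j ∧ j ≤ α i ∧
      f = hsymmOn R (batchInit n α i j) (k - j + 1)}

end SpanningConfig

end

/-! The proof has two halves: the listed polynomials lie in the ideal with known leading monomials,
and those monomials leave too few standard monomials for anything to be missing.

Membership. If A is a set of n-k+1 variables, then modulo the e_d with d > n-k the polynomial ∏(t +
x_i) over all i is divisible by t^k. Splitting it into the monic factors over A and over its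
complement, the latter of degree k-1, forces the k-th power of ∏_{i∈A} x_i to vanish
(`prod_X_pow_mem_esymmIdeal`). The Demazure character κ_{γ(S)^*} is an iterated divided difference
of (x_1⋯x_{n-k+1})^k: a chain of isobaric operators of length l is a chain of ordinary divided
differences applied after multiplication by x_a^l (`isoChain_eq_ddChain`), and l is what the moved
entry lacks from k. Divided differences preserve ideals with symmetric generators, so κ stays in the
ideal (`exists_demazure_factor`); the same induction shows that its leading monomial is x^{γ(S)^*}.
For the h's the recursion on the number of variables suffices. All of this works over ℤ.

Counting. Consider the points of ℚ^n whose coordinates spell words in k letters that use every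
letter and repeat none inside a batch. On these points each generator of degree d agrees with a
polynomial of smaller degree, as generating functions show. Hence the leading monomial of any
nonzero element of J agrees on the points with a combination of monomials that are smaller in the
order "degree, then neglex". The monomials divisible by none of the known leading monomials
therefore span the functions on the points. A coding by words (`exists_words`) injects these
standard monomials into the points, so they form a basis, and a standard monomial cannot be such a
leading monomial (`exists_le_of_monomial_mem_reducible`). -/

noncomputable section

namespace SpanningConfig

open MvPolynomial

/-! ### Divided differences, isobaric operators and their chains. -/

section Operators

variable {σ R : Type*} [DecidableEq σ] [CommRing R]

theorem swapVars_swapVars (i j : σ) (f : MvPolynomial σ R) :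
    swapVars i j (swapVars i j f) = f := by
  simp [swapVars, rename_rename, ← Equiv.Perm.coe_mul]

theorem swapVars_comm {i j k l : σ} (hik : i ≠ k) (hil : i ≠ l) (hjk : j ≠ k) (hjl : j ≠ l)
    (f : MvPolynomial σ R) :
    swapVars i j (swapVars k l f) = swapVars k l (swapVars i j f) := by
  simp only [swapVars, rename_rename]
  congr 2
  rw [← Equiv.Perm.coe_mul, ← Equiv.Perm.coe_mul]
  refine congrArg _ (Equiv.Perm.Disjoint.commute fun a => ?_).eq
  by_cases h : a = i ∨ a = j
  · right
    rcases h with rfl | rfl <;> apply Equiv.swap_apply_of_ne_of_ne <;> assumption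
  · left
    push Not at h
    exact Equiv.swap_apply_of_ne_of_ne h.1 h.2

theorem swapVars_X_of_ne {i j l : σ} (hi : l ≠ i) (hj : l ≠ j) :
    swapVars i j (X l : MvPolynomial σ R) = X l := by
  rw [swapVars_X, Equiv.swap_apply_of_ne_of_ne hi hj]

variable [IsDomain R]

theorem eq_dividedDiff {i j : σ} (hij : i ≠ j) {f g : MvPolynomial σ R}
    (h : (X i - X j) * g = f - swapVars i j f) : g = dividedDiff i j f :=
  mul_left_cancel₀ (X_sub_X_ne_zero (R := R) hij) (h.trans (mul_dividedDiff i j f).symm)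

theorem dividedDiff_add {i j : σ} (hij : i ≠ j) (f g : MvPolynomial σ R) :
    dividedDiff i j (f + g) = dividedDiff i j f + dividedDiff i j g := by
  refine (eq_dividedDiff hij ?_).symm
  rw [mul_add, mul_dividedDiff, mul_dividedDiff, map_add]
  ring

/-- The twisted Leibniz rule for divided differences. -/
theorem dividedDiff_mul {i j : σ} (hij : i ≠ j) (f g : MvPolynomial σ R) :
    dividedDiff i j (f * g) = dividedDiff i j f * g + swapVars i j f * dividedDiff i j g := by
  refine (eq_dividedDiff hij ?_).symm
  have h1 := mul_dividedDiff i j f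
  have h2 := mul_dividedDiff i j g
  rw [map_mul]
  linear_combination g * h1 + swapVars i j f * h2

theorem dividedDiff_of_symm {i j : σ} (hij : i ≠ j) {f : MvPolynomial σ R}
    (hf : swapVars i j f = f) : dividedDiff i j f = 0 :=
  (eq_dividedDiff hij (by rw [hf, mul_zero, sub_self])).symm

theorem dividedDiff_zero {i j : σ} (hij : i ≠ j) :
    dividedDiff i j (0 : MvPolynomial σ R) = 0 :=
  dividedDiff_of_symm hij (map_zero _)

theorem dividedDiff_symm_mul {i j : σ} (hij : i ≠ j) {f : MvPolynomial σ R}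
    (hf : swapVars i j f = f) (g : MvPolynomial σ R) :
    dividedDiff i j (f * g) = f * dividedDiff i j g := by
  rw [dividedDiff_mul hij, dividedDiff_of_symm hij hf, hf, zero_mul, zero_add]

theorem dividedDiff_X_pow {i j : σ} (hij : i ≠ j) (e : ℕ) :
    dividedDiff i j (X i ^ e : MvPolynomial σ R) =
      ∑ p ∈ Finset.range e, X i ^ p * X j ^ (e - 1 - p) := by
  refine (eq_dividedDiff hij ?_).symm
  rw [mul_comm, geom_sum₂_mul, map_pow, swapVars_X, Equiv.swap_apply_left]

theorem isobaric_add {i j : σ} (hij : i ≠ j) (f g : MvPolynomial σ R) :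
    isobaric i j (f + g) = isobaric i j f + isobaric i j g := by
  simp only [isobaric, mul_add, dividedDiff_add hij]

theorem isobaric_symm_mul {i j : σ} (hij : i ≠ j) {f : MvPolynomial σ R}
    (hf : swapVars i j f = f) (g : MvPolynomial σ R) :
    isobaric i j (f * g) = f * isobaric i j g := by
  rw [isobaric, mul_left_comm, dividedDiff_symm_mul hij hf, isobaric]

theorem eq_isobaric {i j : σ} (hij : i ≠ j) {f g : MvPolynomial σ R}
    (h : (X i - X j) * g = X i * f - X j * swapVars i j f) : g = isobaric i j f :=
  mul_left_cancel₀ (X_sub_X_ne_zero (R := R) hij) (h.trans (mul_isobaric i j f).symm)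

theorem isobaric_of_symm {i j : σ} (hij : i ≠ j) {f : MvPolynomial σ R}
    (hf : swapVars i j f = f) : isobaric i j f = f :=
  (eq_isobaric hij (by rw [hf]; ring)).symm

theorem swapVars_isobaric {i j : σ} (hij : i ≠ j) (f : MvPolynomial σ R) :
    swapVars i j (isobaric i j f) = isobaric i j f := by
  refine eq_isobaric hij ?_
  have h := swapVars_mul_isobaric i j i j f
  rw [Equiv.swap_apply_left, Equiv.swap_apply_right, swapVars_swapVars] at h
  linear_combination -h

theorem swapVars_isobaric_comm {i j k l : σ} (hij : i ≠ j) (hik : i ≠ k) (hil : i ≠ l)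
    (hjk : j ≠ k) (hjl : j ≠ l) (f : MvPolynomial σ R) :
    swapVars k l (isobaric i j f) = isobaric i j (swapVars k l f) := by
  refine eq_isobaric hij ?_
  have h := swapVars_mul_isobaric k l i j f
  rwa [Equiv.swap_apply_of_ne_of_ne hik hil, Equiv.swap_apply_of_ne_of_ne hjk hjl,
    ← swapVars_comm hik hil hjk hjl] at h

/-- The composite `π_{a+l-1} ⋯ π_a` of isobaric divided differences along the variables
`x a, x (a + 1), ...`. -/
def isoChain (x : ℕ → σ) (a : ℕ) : ℕ → MvPolynomial σ R → MvPolynomial σ R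
  | 0, f => f
  | l + 1, f => isobaric (x (a + l)) (x (a + l + 1)) (isoChain x a l f)

/-- The composite `∂_{a+l-1} ⋯ ∂_a` of divided differences along the variables
`x a, x (a + 1), ...`. -/
def ddChain (x : ℕ → σ) (a : ℕ) : ℕ → MvPolynomial σ R → MvPolynomial σ R
  | 0, f => f
  | l + 1, f => dividedDiff (x (a + l)) (x (a + l + 1)) (ddChain x a l f)

omit [IsDomain R] in
theorem isoChain_succ (x : ℕ → σ) (a l : ℕ) (f : MvPolynomial σ R) :
    isoChain x a (l + 1) f = isoChain x (a + 1) l (isobaric (x a) (x (a + 1)) f) := by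
  induction l with
  | zero => rfl
  | succ l ih =>
    rw [isoChain, ih, isoChain, show a + (l + 1) = a + 1 + l by omega]

omit [IsDomain R] in
theorem ddChain_succ (x : ℕ → σ) (a l : ℕ) (f : MvPolynomial σ R) :
    ddChain x a (l + 1) f = ddChain x (a + 1) l (dividedDiff (x a) (x (a + 1)) f) := by
  induction l with
  | zero => rfl
  | succ l ih =>
    rw [ddChain, ih, ddChain, show a + (l + 1) = a + 1 + l by omega]

omit [DecidableEq σ] in
theorem chain_ne {x : ℕ → σ} {N : ℕ} (hx : Set.InjOn x (Set.Iic N)) {c d : ℕ} (hc : c ≤ N)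
    (hd : d ≤ N) (h : c ≠ d) : x c ≠ x d :=
  fun e => h (hx hc hd e)

theorem ddChain_add {x : ℕ → σ} {a l : ℕ} (hx : Set.InjOn x (Set.Iic (a + l)))
    (f g : MvPolynomial σ R) : ddChain x a l (f + g) = ddChain x a l f + ddChain x a l g := by
  induction l with
  | zero => rfl
  | succ l ih =>
    rw [ddChain, ih (hx.mono (Set.Iic_subset_Iic.2 (by omega))),
      dividedDiff_add (chain_ne hx (by omega) (by omega) (by omega))]
    rfl

theorem ddChain_zero {x : ℕ → σ} {a l : ℕ} (hx : Set.InjOn x (Set.Iic (a + l))) :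
    ddChain x a l (0 : MvPolynomial σ R) = 0 := by
  simpa using ddChain_add hx (0 : MvPolynomial σ R) 0

theorem ddChain_symm_mul {x : ℕ → σ} {a l : ℕ} (hx : Set.InjOn x (Set.Iic (a + l)))
    {f : MvPolynomial σ R} (hf : ∀ c, a ≤ c → c < a + l → swapVars (x c) (x (c + 1)) f = f)
    (g : MvPolynomial σ R) : ddChain x a l (f * g) = f * ddChain x a l g := by
  induction l with
  | zero => rfl
  | succ l ih =>
    rw [ddChain, ih (hx.mono (Set.Iic_subset_Iic.2 (by omega))) fun c h1 h2 => hf c h1 (by omega),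
      dividedDiff_symm_mul (chain_ne hx (by omega) (by omega) (by omega))
        (hf _ (by omega) (by omega))]
    rfl

theorem isoChain_symm_mul {x : ℕ → σ} {a l : ℕ} (hx : Set.InjOn x (Set.Iic (a + l)))
    {f : MvPolynomial σ R} (hf : ∀ c, a ≤ c → c < a + l → swapVars (x c) (x (c + 1)) f = f)
    (g : MvPolynomial σ R) : isoChain x a l (f * g) = f * isoChain x a l g := by
  induction l with
  | zero => rfl
  | succ l ih =>
    rw [isoChain, ih (hx.mono (Set.Iic_subset_Iic.2 (by omega))) fun c h1 h2 => hf c h1 (by omega),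
      isobaric_symm_mul (chain_ne hx (by omega) (by omega) (by omega))
        (hf _ (by omega) (by omega))]
    rfl

theorem isoChain_add {x : ℕ → σ} {a l : ℕ} (hx : Set.InjOn x (Set.Iic (a + l)))
    (f g : MvPolynomial σ R) : isoChain x a l (f + g) = isoChain x a l f + isoChain x a l g := by
  induction l with
  | zero => rfl
  | succ l ih =>
    rw [isoChain, ih (hx.mono (Set.Iic_subset_Iic.2 (by omega))),
      isobaric_add (chain_ne hx (by omega) (by omega) (by omega))]
    rfl

omit [IsDomain R] in
theorem swapVars_chain_X {x : ℕ → σ} {N : ℕ} (hx : Set.InjOn x (Set.Iic N)) {a c : ℕ}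
    (ha : a ≤ N) (hc : c + 1 ≤ N) (h1 : a ≠ c) (h2 : a ≠ c + 1) :
    swapVars (x c) (x (c + 1)) (X (x a) : MvPolynomial σ R) = X (x a) :=
  swapVars_X_of_ne (chain_ne hx ha (by omega) h1) (chain_ne hx ha hc h2)

/-- Each divided difference lowers the exponent of its active variable: ∂ of x_a^e is a sum of terms
x_a^p x_{a+1}^{e-1-p}, where x_a^p is inert for the rest of the chain. Fewer than l powers are
exhausted before the chain ends. -/
theorem ddChain_X_pow {x : ℕ → σ} {a l e : ℕ} (hx : Set.InjOn x (Set.Iic (a + l))) (h : e < l) :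
    ddChain x a l (X (x a) ^ e : MvPolynomial σ R) = 0 := by
  induction l generalizing a e with
  | zero => omega
  | succ l ih =>
    have hx' : Set.InjOn x (Set.Iic (a + 1 + l)) := hx.mono (Set.Iic_subset_Iic.2 (by omega))
    rw [ddChain_succ, dividedDiff_X_pow (chain_ne hx (by omega) (by omega) (by omega))]
    refine Finset.sum_induction _ (fun f => ddChain x (a + 1) l f = 0)
      (fun f g hf hg => by rw [ddChain_add hx', hf, hg, add_zero]) (ddChain_zero hx')
      fun p hp => ?_
    rw [Finset.mem_range] at hp
    rw [ddChain_symm_mul hx', ih hx' (by omega), mul_zero]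
    intro c h1 h2
    rw [map_pow, swapVars_chain_X hx (by omega) (by omega) (by omega) (by omega)]

theorem isoChain_symm_of_lt {x : ℕ → σ} {a l N : ℕ} (hx : Set.InjOn x (Set.Iic N))
    {f : MvPolynomial σ R} (hf : ∀ c, a + 1 ≤ c → c < N → swapVars (x c) (x (c + 1)) f = f)
    {c : ℕ} (hc : a + l + 1 ≤ c) (hcN : c < N) :
    swapVars (x c) (x (c + 1)) (isoChain x a l f) = isoChain x a l f := by
  induction l with
  | zero => exact hf c (by omega) (by omega)
  | succ l ih =>
    rw [isoChain, swapVars_isobaric_comm, ih (by omega)]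
    all_goals exact chain_ne hx (by omega) (by omega) (by omega)

/-- Only the last operator is visibly symmetric in its own two variables; the braid relation passes
that symmetry down the chain, using that f is already symmetric in the later variables. -/
theorem isoChain_symm {x : ℕ → σ} {a l N : ℕ} (hx : Set.InjOn x (Set.Iic N)) (hl : a + l ≤ N)
    {f : MvPolynomial σ R} (hf : ∀ c, a + 1 ≤ c → c < N → swapVars (x c) (x (c + 1)) f = f)
    {c : ℕ} (hac : a ≤ c) (hcl : c < a + l) :
    swapVars (x c) (x (c + 1)) (isoChain x a l f) = isoChain x a l f := by
  induction l with
  | zero => omega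
  | succ l ih =>
    rcases lt_or_eq_of_le (show c ≤ a + l by omega) with h | rfl
    · rcases eq_or_ne (c + 1) (a + l) with h' | h'
      · obtain ⟨l, rfl⟩ : ∃ l', l = l' + 1 := ⟨l - 1, by omega⟩
        obtain rfl : c = a + l := by omega
        have n1 : x (a + l) ≠ x (a + l + 1) := chain_ne hx (by omega) (by omega) (by omega)
        have n2 : x (a + l + 1) ≠ x (a + l + 2) := chain_ne hx (by omega) (by omega) (by omega)
        have n3 : x (a + l) ≠ x (a + l + 2) := chain_ne hx (by omega) (by omega) (by omega)
        -- Inserting this operator, which acts trivially, completes π_{c+1}π_c to a braid word,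
        -- which can then be rewritten with π_c outermost.
        have h1 : isobaric (x (a + l + 1)) (x (a + l + 2)) (isoChain x a l f) = isoChain x a l f :=
          isobaric_of_symm n2 (isoChain_symm_of_lt hx hf (by omega) (by omega))
        have h2 := isobaric_braid n1 n2 n3 (isoChain x a l f)
        rw [h1] at h2
        have h3 : isoChain x a (l + 1 + 1) f = isobaric (x (a + l + 1)) (x (a + l + 2))
          (isobaric (x (a + l)) (x (a + l + 1)) (isoChain x a l f)) := rfl
        rw [h3, ← h2, swapVars_isobaric n1]
      · rw [isoChain, swapVars_isobaric_comm, ih (by omega) (by omega)]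
        all_goals exact chain_ne hx (by omega) (by omega) (by omega)
    · exact swapVars_isobaric (chain_ne hx (by omega) (by omega) (by omega)) _

/-- This trades isobaric operators, which need not preserve an ideal with symmetric generators, for
divided differences, which do. The price is the factor x_a^l. -/
theorem isoChain_eq_ddChain {x : ℕ → σ} {a l : ℕ} (hx : Set.InjOn x (Set.Iic (a + l)))
    {f : MvPolynomial σ R}
    (hf : ∀ c, a + 1 ≤ c → c < a + l → swapVars (x c) (x (c + 1)) f = f) :
    isoChain x a l f = ddChain x a l (X (x a) ^ l * f) := by
  induction l generalizing a f with
  | zero => simp [isoChain, ddChain]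
  | succ l ih =>
    have hx' : Set.InjOn x (Set.Iic (a + 1 + l)) := hx.mono (Set.Iic_subset_Iic.2 (by omega))
    have n1 : x a ≠ x (a + 1) := chain_ne hx (by omega) (by omega) (by omega)
    have hXf : ∀ c, a + 1 ≤ c → c < a + 1 + l →
        swapVars (x c) (x (c + 1)) (X (x a) * f) = X (x a) * f := by
      intro c h1 h2
      rw [map_mul, hf c (by omega) (by omega),
        swapVars_chain_X hx (by omega) (by omega) (by omega) (by omega)]
    -- The Leibniz rule for ∂(x_a^l · x_a f) gives two terms. In the first, x_a f is inert for the
    -- remaining chain and x_a^l is killed by the l + 1 divided differences; the second is the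
    -- induction hypothesis for π f = ∂(x_a f).
    rw [isoChain_succ, ih hx', ddChain_succ, pow_succ, mul_assoc, dividedDiff_mul n1,
      ddChain_add hx', mul_comm (dividedDiff _ _ _), ddChain_symm_mul hx' hXf, ← ddChain_succ,
      ddChain_X_pow hx (by omega), mul_zero, zero_add, map_pow, swapVars_X,
      Equiv.swap_apply_left, isobaric]
    · intro c h1 h2
      rw [swapVars_isobaric_comm, hf c (by omega) (by omega)]
      all_goals exact chain_ne hx (by omega) (by omega) (by omega)

theorem dividedDiff_mem_span {G : Set (MvPolynomial σ R)} {i j : σ} (hij : i ≠ j)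
    (hG : ∀ g ∈ G, swapVars i j g = g) {f : MvPolynomial σ R} (hf : f ∈ Ideal.span G) :
    dividedDiff i j f ∈ Ideal.span G := by
  induction hf using Submodule.span_induction with
  | mem g hg => rw [dividedDiff_of_symm hij (hG g hg)]; exact zero_mem _
  | zero => rw [dividedDiff_zero hij]; exact zero_mem _
  | add f g _ _ h1 h2 => rw [dividedDiff_add hij]; exact add_mem h1 h2
  | smul a f hf h =>
    rw [smul_eq_mul, dividedDiff_mul hij]
    exact add_mem (Ideal.mul_mem_left _ _ hf) (Ideal.mul_mem_left _ _ h)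

end Operators

/-! ### Complete homogeneous polynomials in a subset of the variables. -/

section CompleteHomogeneous

variable {R : Type*} [CommRing R] {n : ℕ}

theorem prod_map_X_eq_monomial {σ R : Type*} [CommSemiring R] [DecidableEq σ] (s : Multiset σ) :
    (s.map (X : σ → MvPolynomial σ R)).prod = monomial (Multiset.toFinsupp s) 1 := by
  induction s using Multiset.induction with
  | empty => simp
  | cons a s ih =>
    rw [Multiset.map_cons, Multiset.prod_cons, ih, X, monomial_mul, one_mul,
      ← Multiset.singleton_add, map_add, Multiset.toFinsupp_singleton]

open Classical in
/-- `h_d` in the variables of `A` is the sum of all monomials of degree `d` supported in `A`. -/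
theorem coeff_hsymmOn (A : Finset (Fin n)) (d : ℕ) (δ : Fin n →₀ ℕ) :
    coeff δ (hsymmOn R A d) = if δ.support ⊆ A ∧ δ.degree = d then 1 else 0 := by
  have h1 : hsymmOn R A d = ∑ s : Sym A d,
      monomial (Multiset.toFinsupp ((s : Multiset A).map Subtype.val)) (1 : R) := by
    rw [hsymmOn, hsymm, map_sum]
    refine Finset.sum_congr rfl fun s _ => ?_
    rw [map_multiset_prod, Multiset.map_map, ← prod_map_X_eq_monomial, Multiset.map_map]
    simp [Function.comp_def]
  have h2 : ∀ s : Sym A d, (Multiset.toFinsupp ((s : Multiset A).map Subtype.val)).support ⊆ A ∧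
      (Multiset.toFinsupp ((s : Multiset A).map (Subtype.val : A → Fin n))).degree = d := by
    intro s
    constructor
    · intro a ha
      rw [Multiset.toFinsupp_support, Multiset.mem_toFinset, Multiset.mem_map] at ha
      obtain ⟨b, -, rfl⟩ := ha
      exact b.2
    · have := Multiset.toFinsupp_sum_eq ((s : Multiset A).map (Subtype.val : A → Fin n))
      rw [Multiset.card_map, Sym.card_coe] at this
      rw [Finsupp.degree_apply]
      exact this
  rw [h1, coeff_sum]
  simp only [coeff_monomial]
  split_ifs with h
  · obtain ⟨hA, hd⟩ := h
    have hm : ∀ a ∈ Finsupp.toMultiset δ, a ∈ A := fun a ha => hA (by simpa using ha)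
    have e : ((Finsupp.toMultiset δ).attach.map fun a => (⟨a.1, hm a.1 a.2⟩ : A)).map
        Subtype.val = Finsupp.toMultiset δ := by
      rw [Multiset.map_map]
      exact Multiset.attach_map_val _
    have hc : ((Finsupp.toMultiset δ).attach.map fun a => (⟨a.1, hm a.1 a.2⟩ : A)).card = d := by
      rw [Multiset.card_map, Multiset.card_attach, Finsupp.card_toMultiset, ← hd]
      rfl
    rw [Finset.sum_eq_single (Sym.mk _ hc)]
    · exact if_pos ((congrArg Multiset.toFinsupp e).trans (Finsupp.toMultiset_toFinsupp δ))
    · intro s _ hs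
      rw [if_neg]
      intro h'
      apply hs
      apply Subtype.ext
      apply Multiset.map_injective Subtype.val_injective
      refine Eq.trans ?_ e.symm
      rw [← h', Multiset.toFinsupp_toMultiset]
      rfl
    · simp
  · refine Finset.sum_eq_zero fun s _ => if_neg ?_
    rintro rfl
    exact h (h2 s)

theorem hsymmOn_zero (A : Finset (Fin n)) : hsymmOn R A 0 = 1 := by
  rw [hsymmOn, hsymm_zero, map_one]

theorem map_hsymmOn {S : Type*} [CommRing S] (f : R →+* S) (A : Finset (Fin n)) (d : ℕ) :
    map f (hsymmOn R A d) = hsymmOn S A d := by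
  rw [hsymmOn, map_rename, map_hsymm, hsymmOn]

/-- The monomials of h_{d+1} split into those free of x_p and those divisible by it. -/
theorem hsymmOn_insert {A : Finset (Fin n)} {p : Fin n} (hp : p ∉ A) (d : ℕ) :
    hsymmOn R (insert p A) (d + 1) =
      hsymmOn R A (d + 1) + X p * hsymmOn R (insert p A) d := by
  classical
  ext δ
  rw [coeff_add, coeff_X_mul', coeff_hsymmOn, coeff_hsymmOn, coeff_hsymmOn]
  by_cases h : p ∈ δ.support
  · have h1 : ¬ δ.support ⊆ A := fun h' => hp (h' h)
    have h2 : Finsupp.single p 1 ≤ δ := by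
      simpa [Nat.one_le_iff_ne_zero] using h
    obtain ⟨ε, rfl⟩ := exists_add_of_le h2
    rw [if_pos h, if_neg (show ¬ (_ ∧ _) from fun h' => h1 h'.1), zero_add, add_tsub_cancel_left]
    have h3 : (Finsupp.single p 1 + ε).support ⊆ insert p A ↔ ε.support ⊆ insert p A := by
      constructor
      · intro h' a ha
        apply h'
        simp only [Finsupp.mem_support_iff, Finsupp.add_apply] at ha ⊢
        omega
      · intro h' a ha
        rcases eq_or_ne a p with rfl | hap
        · simp
        · apply h'
          simpa [Finsupp.single_apply, hap.symm] using ha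
    simp only [h3, map_add, Finsupp.degree_single]
    congr 1
    simp only [add_comm 1, add_left_inj]
  · rw [if_neg h, add_zero]
    congr 1
    rw [Finset.subset_insert_iff_of_notMem h]

theorem hsymmOn_empty (d : ℕ) : hsymmOn R (∅ : Finset (Fin n)) (d + 1) = 0 := by
  classical
  ext δ
  rw [coeff_hsymmOn, coeff_zero, if_neg]
  rintro ⟨h1, h2⟩
  rw [Finset.subset_empty, Finsupp.support_eq_empty] at h1
  subst h1
  simp at h2

/-- The right side is the numerator of an isobaric operator, so this says that the operator adds the
variable x_q to h_d. -/
theorem X_mul_hsymmOn_sub {A : Finset (Fin n)} {p q : Fin n} (hp : p ∉ A) (hq : q ∉ A)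
    (hpq : p ≠ q) (d : ℕ) :
    (X p - X q) * hsymmOn R (insert q (insert p A)) d =
      X p * hsymmOn R (insert p A) d - X q * hsymmOn R (insert q A) d := by
  cases d with
  | zero => simp [hsymmOn_zero]
  | succ d =>
    have h1 := hsymmOn_insert (R := R) (A := insert p A) (p := q) (by simp [hq, hpq.symm]) d
    have h2 := hsymmOn_insert (R := R) (A := insert q A) (p := p) (by simp [hp, hpq]) d
    rw [Finset.insert_comm p q] at h2
    linear_combination X p * h1 - X q * h2

/-- The exchange of `x_p` and `x_q` replaces `p` by `q` in the set of variables of `h_d`. -/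
theorem swapVars_hsymmOn {A : Finset (Fin n)} {p q : Fin n} (hp : p ∉ A) (hq : q ∉ A) (d : ℕ) :
    swapVars p q (hsymmOn R (insert p A) d) = hsymmOn R (insert q A) d := by
  classical
  ext δ
  have e : δ = (δ.mapDomain (Equiv.swap p q)).mapDomain (Equiv.swap p q) := by
    rw [← Finsupp.mapDomain_comp, ← Equiv.Perm.coe_mul, Equiv.swap_mul_self, Equiv.Perm.coe_one,
      Finsupp.mapDomain_id]
  rw [swapVars, e, coeff_rename_mapDomain _ (Equiv.injective _), coeff_hsymmOn, coeff_hsymmOn, ← e]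
  congr 1
  rw [eq_iff_iff]
  refine and_congr ?_ ?_
  · rw [Finsupp.mapDomain_support_of_injective (Equiv.injective _)]
    simp only [Finset.subset_iff, Finset.mem_image, forall_exists_index, and_imp,
      forall_apply_eq_imp_iff₂]
    refine forall₂_congr fun a _ => ?_
    rw [Finset.mem_insert, Finset.mem_insert]
    rcases eq_or_ne a p with rfl | ha
    · rw [Equiv.swap_apply_left]; simp [hp, hq, eq_comm]
    rcases eq_or_ne a q with rfl | ha'
    · simp
    · simp [Equiv.swap_apply_of_ne_of_ne ha ha', ha, ha']
  · rw [Finsupp.degree_mapDomain]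

end CompleteHomogeneous

/-! ### Powers of square-free monomials in the ideal of elementary symmetric polynomials. -/

section ElementaryIdeal

/-- If `t ^ k` divides a product `P * Q` of monic polynomials with `deg Q < k`, then the `k`-th
power of the constant coefficient of `P` vanishes. -/
theorem coeff_zero_pow_eq_zero {A : Type*} [CommRing A] {P Q : Polynomial A} {k : ℕ}
    (hP : P.Monic) (hQ : Q.Monic) (hk : Q.natDegree < k) (h : Polynomial.X ^ k ∣ P * Q) :
    P.coeff 0 ^ k = 0 := by
  nontriviality A
  obtain ⟨F, hF⟩ := h
  have hFm : F.Monic := (Polynomial.monic_X_pow k).of_mul_monic_left (hF ▸ hP.mul hQ)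
  have hdeg : F.natDegree < P.natDegree := by
    have := congrArg Polynomial.natDegree hF
    rw [hP.natDegree_mul hQ, (Polynomial.monic_X_pow k).natDegree_mul hFm,
      Polynomial.natDegree_X_pow] at this
    omega
  -- One factor t is traded for one factor c = P(0) at a time. While t still divides the right side,
  -- comparison of constant terms gives c·Q'(0) = 0, so c·Q' is divisible by t.
  have key : ∀ j ≤ k, ∃ Q' : Polynomial A,
      P * Q' = Polynomial.C (P.coeff 0 ^ j) * (Polynomial.X ^ (k - j) * F) := by
    intro j
    induction j with
    | zero => exact fun _ => ⟨Q, by simpa using hF⟩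
    | succ j ih =>
      intro hj
      obtain ⟨Q', hQ'⟩ := ih (by omega)
      have h0 : P.coeff 0 * Q'.coeff 0 = 0 := by
        have := congrArg (fun p => Polynomial.coeff p 0) hQ'
        simp only [Polynomial.mul_coeff_zero, Polynomial.coeff_X_pow] at this
        rw [this, if_neg (by omega), zero_mul, mul_zero]
      have hX : Polynomial.X ∣ Polynomial.C (P.coeff 0) * Q' := by
        rw [Polynomial.X_dvd_iff, Polynomial.mul_coeff_zero, Polynomial.coeff_C_zero, h0]
      obtain ⟨Q'', hQ''⟩ := hX
      refine ⟨Q'', ?_⟩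
      apply (Polynomial.isRegular_X (R := A)).left
      change Polynomial.X * (P * Q'') = Polynomial.X * _
      have e : k - j = k - (j + 1) + 1 := by omega
      rw [e, pow_succ] at hQ'
      rw [pow_succ, Polynomial.C_mul]
      linear_combination Polynomial.C (P.coeff 0) * hQ' - P * hQ''
  obtain ⟨Q', hQ'⟩ := key k le_rfl
  rw [Nat.sub_self, pow_zero, one_mul] at hQ'
  -- No power of t is left: P is monic of degree larger than F, so a multiple of P can equal c^k F
  -- only if it is zero.
  have hQ0 : Q' = 0 := by
    by_contra hne
    have h1 := congrArg Polynomial.natDegree hQ'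
    rw [hP.natDegree_mul' hne] at h1
    have h2 := Polynomial.natDegree_C_mul_le (P.coeff 0 ^ k) F
    omega
  rw [hQ0, mul_zero] at hQ'
  have := congrArg (fun p => Polynomial.coeff p F.natDegree) hQ'
  simpa only [Polynomial.coeff_C_mul, hFm.coeff_natDegree, mul_one, Polynomial.coeff_zero] using
    this.symm

/-- The ideal generated by `e_d(x_1, ..., x_n)` for `n - k + 1 ≤ d ≤ n`. -/
def esymmIdeal (R : Type*) [CommRing R] (n k : ℕ) : Ideal (MvPolynomial (Fin n) R) :=
  Ideal.span {f | ∃ d, n + 1 ≤ d + k ∧ d ≤ n ∧ f = esymm (Fin n) R d}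

/-- In the quotient, ∏(t + x_i) = ∑ e_j t^{n-j} keeps only the terms with n - j ≥ k. The factor over
the complement of A has degree k - 1, and the constant term of the factor over A is the product in
question. -/
theorem prod_X_pow_mem_esymmIdeal (R : Type*) [CommRing R] {n k : ℕ} (A : Finset (Fin n))
    (hA : A.card + k = n + 1) : (∏ i ∈ A, (X i : MvPolynomial (Fin n) R)) ^ k ∈ esymmIdeal R n k := by
  set q := Ideal.Quotient.mk (esymmIdeal R n k) with hq
  let P : Finset (Fin n) → Polynomial (MvPolynomial (Fin n) R ⧸ esymmIdeal R n k) :=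
    fun B => ∏ i ∈ B, (Polynomial.X + Polynomial.C (q (X i)))
  have hm : ∀ B, (P B).Monic := fun B =>
    Polynomial.monic_prod_of_monic _ _ fun i _ => Polynomial.monic_X_add_C _
  have hd : (P Aᶜ).natDegree < k := by
    refine lt_of_le_of_lt (Polynomial.natDegree_prod_le _ _) ?_
    refine lt_of_le_of_lt (Finset.sum_le_card_nsmul _ _ 1 fun i _ =>
      (Polynomial.natDegree_add_C).trans_le Polynomial.natDegree_X_le) ?_
    have := Finset.card_le_univ A
    rw [Fintype.card_fin] at this
    rw [Finset.card_compl, Fintype.card_fin, smul_eq_mul, mul_one]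
    omega
  have hdvd : Polynomial.X ^ k ∣ P A * P Aᶜ := by
    have h1 : P A * P Aᶜ = ∏ i, (Polynomial.X + Polynomial.C (q (X i))) :=
      Finset.prod_mul_prod_compl _ _
    have h2 := congrArg (Polynomial.map q) (prod_C_add_X_eq_sum_esymm R (Fin n))
    rw [Polynomial.map_prod, Polynomial.map_sum] at h2
    simp only [Polynomial.map_add, Polynomial.map_X, Polynomial.map_C, Polynomial.map_mul,
      Polynomial.map_pow, Fintype.card_fin] at h2
    rw [h1, h2]
    refine Finset.dvd_sum fun j hj => ?_
    rw [Finset.mem_range] at hj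
    by_cases hjk : n + 1 ≤ j + k
    · have : q (esymm (Fin n) R j) = 0 :=
        Ideal.Quotient.eq_zero_iff_mem.2 (Ideal.subset_span ⟨j, hjk, by omega, rfl⟩)
      rw [this, Polynomial.C_0, zero_mul]
      exact dvd_zero _
    · obtain ⟨l, hl⟩ := Nat.exists_eq_add_of_le (show k ≤ n - j by omega)
      exact ⟨Polynomial.C (q (esymm (Fin n) R j)) * Polynomial.X ^ l, by rw [hl, pow_add]; ring⟩
  have h := coeff_zero_pow_eq_zero (hm A) (hm Aᶜ) hd hdvd
  rw [← Ideal.Quotient.eq_zero_iff_mem, ← hq, map_pow, map_prod, ← h, Polynomial.coeff_zero_prod]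
  simp

end ElementaryIdeal

/-! ### Leading monomials and supports under isobaric operators. -/

section Leading

variable {R : Type*} [CommRing R] {n : ℕ}

open scoped MonomialOrder in
/-- `f` has leading monomial `x ^ μ` with coefficient `1` in `neglex`. -/
def HasLead (f : MvPolynomial (Fin n) R) (μ : Fin n →₀ ℕ) : Prop :=
  coeff μ f = 1 ∧ ∀ δ, coeff δ f ≠ 0 → δ ≠ μ → δ ≺[neglex n] μ

theorem HasLead.degree_eq [Nontrivial R] {f : MvPolynomial (Fin n) R} {μ : Fin n →₀ ℕ}
    (h : HasLead f μ) : (neglex n).degree f = μ := by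
  apply (neglex n).toSyn.injective
  apply le_antisymm
  · rw [MonomialOrder.degree_le_iff]
    intro δ hδ
    rcases eq_or_ne δ μ with rfl | hne
    · exact le_rfl
    · exact (h.2 δ (mem_support_iff.1 hδ) hne).le
  · refine MonomialOrder.le_degree (mem_support_iff.2 ?_)
    rw [h.1]
    exact one_ne_zero

theorem HasLead.leadingCoeff_eq [Nontrivial R] {f : MvPolynomial (Fin n) R} {μ : Fin n →₀ ℕ}
    (h : HasLead f μ) : (neglex n).leadingCoeff f = 1 := by
  rw [MonomialOrder.leadingCoeff, h.degree_eq, h.1]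

theorem hasLead_hsymmOn {A : Finset (Fin n)} {p : Fin n} (hp : p ∈ A) (hA : ∀ a ∈ A, a ≤ p)
    (d : ℕ) : HasLead (hsymmOn R A d) (Finsupp.single p d) := by
  classical
  constructor
  · rw [coeff_hsymmOn, if_pos]
    refine ⟨(Finsupp.support_single_subset).trans (by simpa using hp), Finsupp.degree_single _ _⟩
  · intro δ hδ hne
    rw [coeff_hsymmOn, ite_ne_right_iff] at hδ
    obtain ⟨⟨h1, h2⟩, -⟩ := hδ
    rw [neglex_lt_iff]
    have hz : ∀ j, p < j → δ j = 0 := fun j hj => by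
      by_contra h
      exact absurd (hA j (h1 (Finsupp.mem_support_iff.2 h))) (not_le.2 hj)
    refine ⟨p, ?_, fun j hj => by rw [hz j hj, Finsupp.single_eq_of_ne hj.ne']⟩
    rw [Finsupp.single_eq_same]
    by_contra hlt
    apply hne
    rw [Finsupp.degree_eq_sum, ← Finset.add_sum_erase _ _ (Finset.mem_univ p)] at h2
    have h3 : ∑ a ∈ Finset.univ.erase p, δ a = 0 := by omega
    rw [Finset.sum_eq_zero_iff] at h3
    ext a
    rcases eq_or_ne a p with rfl | ha
    · rw [Finsupp.single_eq_same]; omega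
    · rw [h3 a (by simp [ha]), Finsupp.single_eq_of_ne ha]

theorem restrictSupport_X_mul {s : Set (Fin n →₀ ℕ)} {p : Fin n}
    (hs : ∀ δ ∈ s, Finsupp.single p 1 + δ ∈ s) {f : MvPolynomial (Fin n) R}
    (hf : f ∈ restrictSupport R s) : X p * f ∈ restrictSupport R s := by
  rw [mem_restrictSupport_iff] at hf ⊢
  intro δ hδ
  rw [support_X_mul] at hδ
  simp only [Finset.coe_map, Set.mem_image, addLeftEmbedding_apply] at hδ
  obtain ⟨ε, hε, rfl⟩ := hδ
  exact hs ε (hf hε)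

/-- Here s does not depend on the exponents of x_p and x_q, the only ones the operator can alter.
This carries "smaller at a later variable" through a chain. -/
theorem restrictSupport_isobaric [IsDomain R] {s : Set (Fin n →₀ ℕ)} {p q : Fin n} (hpq : p ≠ q)
    (hs : ∀ δ ε : Fin n →₀ ℕ, (∀ i, i ≠ p → i ≠ q → δ i = ε i) → δ ∈ s → ε ∈ s)
    {f : MvPolynomial (Fin n) R} (hf : f ∈ restrictSupport R s) :
    isobaric p q f ∈ restrictSupport R s := by
  classical
  have hXp : ∀ δ : Fin n →₀ ℕ, ∀ i, i ≠ p → i ≠ q → δ i = (Finsupp.single p 1 + δ : Fin n →₀ ℕ) i := by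
    intro δ i h1 h2
    simp [h1]
  have hXq : ∀ δ : Fin n →₀ ℕ, ∀ i, i ≠ p → i ≠ q → δ i = (Finsupp.single q 1 + δ : Fin n →₀ ℕ) i := by
    intro δ i h1 h2
    simp [h2]
  have hsc : ∀ δ ε : Fin n →₀ ℕ, (∀ i, i ≠ p → i ≠ q → δ i = ε i) → δ ∈ sᶜ → ε ∈ sᶜ :=
    fun δ ε h h1 h2 => h1 (hs ε δ (fun i hi hj => (h i hi hj).symm) h2)
  have hmul : ∀ {s : Set (Fin n →₀ ℕ)},
      (∀ δ ε : Fin n →₀ ℕ, (∀ i, i ≠ p → i ≠ q → δ i = ε i) → δ ∈ s → ε ∈ s) →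
      ∀ g ∈ restrictSupport R s, (X p - X q) * g ∈ restrictSupport R s := by
    intro s hs g hg
    rw [sub_mul]
    exact sub_mem (restrictSupport_X_mul (fun δ h => hs _ _ (hXp δ) h) hg)
      (restrictSupport_X_mul (fun δ h => hs _ _ (hXq δ) h) hg)
  set g := isobaric p q f with hg
  set g1 := ∑ δ ∈ g.support with δ ∈ s, monomial δ (coeff δ g) with hg1
  set g2 := ∑ δ ∈ g.support with δ ∉ s, monomial δ (coeff δ g) with hg2
  have hgs : g = g1 + g2 := by
    rw [hg1, hg2, Finset.sum_filter_add_sum_filter_not, support_sum_monomial_coeff]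
  have hmon : ∀ (s : Set (Fin n →₀ ℕ)) (δ) (a : R), δ ∈ s → monomial δ a ∈ restrictSupport R s := by
    intro s δ a hδ
    rw [mem_restrictSupport_iff]
    intro ε hε
    have := support_monomial_subset hε
    rw [Finset.mem_singleton] at this
    rwa [this]
  have h1 : g1 ∈ restrictSupport R s :=
    Submodule.sum_mem _ fun δ hδ => hmon _ _ _ (Finset.mem_filter.1 hδ).2
  have h2 : g2 ∈ restrictSupport R sᶜ :=
    Submodule.sum_mem _ fun δ hδ => hmon _ _ _ (Finset.mem_filter.1 hδ).2
  have hsw : swapVars p q f ∈ restrictSupport R s := by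
    rw [mem_restrictSupport_iff] at hf ⊢
    intro δ hδ
    rw [swapVars, support_rename_of_injective (Equiv.injective _)] at hδ
    simp only [Finset.coe_image, Set.mem_image] at hδ
    obtain ⟨ε, hε, rfl⟩ := hδ
    refine hs ε _ (fun i hi hj => ?_) (hf hε)
    conv_rhs => rw [← Equiv.swap_apply_of_ne_of_ne hi hj]
    rw [Finsupp.mapDomain_apply (Equiv.injective _)]
  -- The part g2 outside s, times x_p - x_q, is supported outside s; by the defining identity of the
  -- operator it is supported inside s as well. So it is zero.
  have h3 : (X p - X q) * g2 ∈ restrictSupport R s := by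
    have e : (X p - X q) * g2 = X p * f - X q * swapVars p q f - (X p - X q) * g1 := by
      rw [← mul_isobaric p q f, ← hg, hgs]
      ring
    rw [e]
    exact sub_mem (sub_mem (restrictSupport_X_mul (fun δ h => hs _ _ (hXp δ) h) hf)
      (restrictSupport_X_mul (fun δ h => hs _ _ (hXq δ) h) hsw)) (hmul hs _ h1)
  have h4 := hmul hsc _ h2
  have h5 : (X p - X q) * g2 = 0 := by
    rw [mem_restrictSupport_iff] at h3 h4
    rw [← support_eq_empty, Finset.eq_empty_iff_forall_notMem]
    exact fun δ hδ => h4 hδ (h3 hδ)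
  have h6 : g2 = 0 := (mul_eq_zero.1 h5).resolve_left (X_sub_X_ne_zero hpq)
  rw [hgs, h6, add_zero]
  exact h1

end Leading

/-! ### Combinatorics of reverse skip sequences and leading terms of isobaric chains. -/

section DemazureExpansion

variable {R : Type*} [CommRing R] [IsDomain R] {n : ℕ}

/-- The reverse skip sequence of the reversed set `T`: the entry at `t ∈ T` is one more than the
number of positions after `t` outside `T`. -/
def gapSeq (T : Finset (Fin n)) (t : Fin n) : ℕ :=
  if t ∈ T then (Finset.univ.filter fun p => p ∉ T ∧ t < p).card + 1 else 0

theorem gapSeq_insert_of_lt {t p : Fin n} {T : Finset (Fin n)} (h : t < p) :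
    gapSeq (insert t T) p = gapSeq T p := by
  have e : ∀ q, p ≤ q → (q ∈ insert t T ↔ q ∈ T) := fun q hq => by
    rw [Finset.mem_insert, or_iff_right (h.trans_le hq).ne']
  unfold gapSeq
  simp only [e p le_rfl]
  congr 3
  ext q
  simp only [Finset.mem_filter, Finset.mem_univ, true_and]
  constructor <;> rintro ⟨h1, h2⟩ <;> exact ⟨by simpa only [e q h2.le] using h1, h2⟩

theorem gapSeq_le_of_lt {t p : Fin n} {T : Finset (Fin n)} (h : t < p) :
    gapSeq T p ≤ gapSeq (insert t T) t := by
  rw [← gapSeq_insert_of_lt h, gapSeq, gapSeq, if_pos (Finset.mem_insert_self t T)]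
  split_ifs
  · gcongr with q hq
  · omega

/-- Of the n - 1 - t positions after t, exactly |T| belong to T. This count makes chain length plus
entry equal to k in `exists_demazure_factor`. -/
theorem gapSeq_insert_self {t : Fin n} {T : Finset (Fin n)} (h : ∀ p ∈ T, t < p) :
    gapSeq (insert t T) t + t + T.card = n := by
  rw [gapSeq, if_pos (Finset.mem_insert_self t T)]
  have h1 : (Finset.univ.filter fun p => p ∉ insert t T ∧ t < p) = Finset.Ioi t \ T := by
    ext p
    simp only [Finset.mem_filter, Finset.mem_univ, true_and, Finset.mem_insert, Finset.mem_sdiff,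
      Finset.mem_Ioi, not_or]
    constructor
    · exact fun h' => ⟨h'.2, h'.1.2⟩
    · exact fun h' => ⟨⟨h'.1.ne', h'.2⟩, h'.1⟩
  have h2 : T ⊆ Finset.Ioi t := fun p hp => Finset.mem_Ioi.2 (h p hp)
  have h3 := Finset.card_le_card h2
  rw [h1, Finset.card_sdiff_of_subset h2]
  rw [Fin.card_Ioi] at h3 ⊢
  omega

theorem isoChain_X_pow {x : ℕ → Fin n} {a l : ℕ} (hx : Set.InjOn x (Set.Iic (a + l))) (v : ℕ) :
    isoChain x a l (X (x a) ^ v : MvPolynomial (Fin n) R) =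
      hsymmOn R ((Finset.Icc a (a + l)).image x) v := by
  induction l with
  | zero =>
    rw [add_zero, Finset.Icc_self, Finset.image_singleton, isoChain]
    induction v with
    | zero => rw [pow_zero, hsymmOn_zero]
    | succ v ih =>
      rw [← insert_empty_eq, hsymmOn_insert (Finset.notMem_empty _), hsymmOn_empty, zero_add,
        insert_empty_eq, ← ih, pow_succ']
  | succ l ih =>
    have nm : ∀ c, a + l ≤ c → c ≤ a + (l + 1) → x c ∉ (Finset.Ico a (a + l)).image x := by
      intro c hc hc' h
      rw [Finset.mem_image] at h
      obtain ⟨d, hd, e⟩ := h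
      rw [Finset.mem_Ico] at hd
      exact chain_ne hx (by omega) hc' (by omega) e
    have ne : x (a + l) ≠ x (a + l + 1) := chain_ne hx (by omega) (by omega) (by omega)
    rw [isoChain, ih (hx.mono (Set.Iic_subset_Iic.2 (by omega)))]
    have e1 : Finset.Icc a (a + l) = insert (a + l) (Finset.Ico a (a + l)) := by
      ext; simp only [Finset.mem_Icc, Finset.mem_insert, Finset.mem_Ico]; omega
    have e2 : Finset.Icc a (a + (l + 1)) = insert (a + l + 1) (Finset.Icc a (a + l)) := by
      ext; simp only [Finset.mem_Icc, Finset.mem_insert]; omega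
    rw [e2, e1, Finset.image_insert, Finset.image_insert, Finset.image_insert]
    refine (eq_isobaric ne ?_).symm
    rw [swapVars_hsymmOn (nm _ le_rfl (by omega)) (nm _ (by omega) (by omega)),
      X_mul_hsymmOn_sub (nm _ le_rfl (by omega)) (nm _ (by omega) (by omega)) ne]

omit [IsDomain R] in
theorem swapVars_monomial_of_eq_zero {p q : Fin n} {μ : Fin n →₀ ℕ} (hp : μ p = 0) (hq : μ q = 0)
    (a : R) : swapVars p q (monomial μ a) = monomial μ a := by
  rw [swapVars, rename_monomial]
  suffices h : Finsupp.mapDomain (Equiv.swap p q) μ = μ by rw [h]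
  ext i
  conv_lhs => rw [← Equiv.swap_apply_self p q i]
  rw [Finsupp.mapDomain_apply (Equiv.injective _)]
  rcases eq_or_ne i p with rfl | hip
  · rw [Equiv.swap_apply_left, hp, hq]
  rcases eq_or_ne i q with rfl | hiq
  · rw [Equiv.swap_apply_right, hp, hq]
  rw [Equiv.swap_apply_of_ne_of_ne hip hiq]

theorem isoChain_mem_restrictSupport {s : Set (Fin n →₀ ℕ)} {x : ℕ → Fin n} {a l : ℕ}
    (hx : Set.InjOn x (Set.Iic (a + l)))
    (hs : ∀ δ ε : Fin n →₀ ℕ, (∀ i, (∀ c, a ≤ c → c ≤ a + l → i ≠ x c) → δ i = ε i) →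
      δ ∈ s → ε ∈ s)
    {f : MvPolynomial (Fin n) R} (hf : f ∈ restrictSupport R s) :
    isoChain x a l f ∈ restrictSupport R s := by
  induction l with
  | zero => exact hf
  | succ l ih =>
    rw [isoChain]
    refine restrictSupport_isobaric (chain_ne hx (by omega) (by omega) (by omega)) ?_
      (ih (hx.mono (Set.Iic_subset_Iic.2 (by omega)))
        fun δ ε h => hs δ ε fun i hi => h i fun c h1 h2 => hi c h1 (by omega))
    exact fun δ ε h => hs δ ε fun i hi => h i (hi _ (by omega) (by omega)) (hi _ (by omega) le_rfl)

/-- The leading monomial of g involves only variables after the chain, so it factors out and leaves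
h_v of the chain variables, led by the v-th power of the last one. The other terms of g lose to μ at
a variable after the chain, where the operators cannot repair it. -/
theorem hasLead_isoChain {x : ℕ → Fin n} {a l : ℕ} (hx : Set.InjOn x (Set.Iic (a + l)))
    (hxm : ∀ c, a ≤ c → c ≤ a + l → x c ≤ x (a + l)) {g : MvPolynomial (Fin n) R}
    {μ : Fin n →₀ ℕ} (hg : HasLead g μ) (hμ : ∀ i, i ≤ x (a + l) → μ i = 0) (v : ℕ) :
    HasLead (isoChain x a l (X (x a) ^ v * g)) (Finsupp.single (x (a + l)) v + μ) := by
  classical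
  set t := x (a + l) with ht
  set s : Set (Fin n →₀ ℕ) := {δ | ∃ i, t < i ∧ δ i < μ i ∧ ∀ j, i < j → δ j = μ j} with hs
  have hsinv : ∀ δ ε : Fin n →₀ ℕ, (∀ i, (∀ c, a ≤ c → c ≤ a + l → i ≠ x c) → δ i = ε i) →
      δ ∈ s → ε ∈ s := by
    rintro δ ε h ⟨i, h1, h2, h3⟩
    have h' : ∀ j, t < j → δ j = ε j := fun j hj =>
      h j fun c hc hc' => (lt_of_le_of_lt (hxm c hc hc') hj).ne'
    exact ⟨i, h1, h' i h1 ▸ h2, fun j hj => h' j (h1.trans hj) ▸ h3 j hj⟩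
  -- A strict loss to μ cannot occur at an index up to t, since μ is zero there.
  have hlow : g - monomial μ 1 ∈ restrictSupport R s := by
    rw [mem_restrictSupport_iff]
    intro δ hδ
    rw [Finset.mem_coe, mem_support_iff, coeff_sub, coeff_monomial] at hδ
    have hne : δ ≠ μ := by
      rintro rfl
      rw [if_pos rfl, hg.1, sub_self] at hδ
      exact hδ rfl
    rw [if_neg hne.symm, sub_zero] at hδ
    obtain ⟨i, h1, h2⟩ := (neglex_lt_iff _ _).1 (hg.2 δ hδ hne)
    refine ⟨i, lt_of_not_ge fun hi => ?_, h1, h2⟩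
    rw [hμ i hi] at h1
    omega
  have hXpow : ∀ v, X (x a) ^ v * (g - monomial μ 1) ∈ restrictSupport R s := by
    intro v
    induction v with
    | zero => simpa using hlow
    | succ v ih =>
      rw [pow_succ', mul_assoc]
      refine restrictSupport_X_mul (fun δ hδ => hsinv δ _ (fun i hi => ?_) hδ) ih
      simp [hi a le_rfl (by omega)]
  have hmem := isoChain_mem_restrictSupport hx hsinv (hXpow v)
  set low := isoChain x a l (X (x a) ^ v * (g - monomial μ 1)) with hlow'
  have key : isoChain x a l (X (x a) ^ v * g) =
      monomial μ 1 * hsymmOn R ((Finset.Icc a (a + l)).image x) v + low := by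
    have e : X (x a) ^ v * g = monomial μ 1 * X (x a) ^ v +
        X (x a) ^ v * (g - monomial μ 1) := by ring
    rw [e, isoChain_add hx, isoChain_symm_mul hx, isoChain_X_pow hx]
    intro c h1 h2
    exact swapVars_monomial_of_eq_zero (hμ _ (hxm c h1 (by omega)))
      (hμ _ (hxm (c + 1) (by omega) (by omega))) 1
  have hh : HasLead (hsymmOn R ((Finset.Icc a (a + l)).image x) v) (Finsupp.single t v) := by
    refine hasLead_hsymmOn (Finset.mem_image.2 ⟨a + l, by simp, rfl⟩) ?_ v
    intro p hp
    rw [Finset.mem_image] at hp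
    obtain ⟨c, hc, rfl⟩ := hp
    rw [Finset.mem_Icc] at hc
    exact hxm c hc.1 hc.2
  rw [mem_restrictSupport_iff] at hmem
  rw [key]
  constructor
  · have h1 : coeff (Finsupp.single t v + μ) low = 0 := by
      by_contra h
      obtain ⟨i, h1, h2, -⟩ := hmem (mem_support_iff.2 h)
      rw [Finsupp.add_apply] at h2
      omega
    rw [coeff_add, h1, add_zero, add_comm, coeff_monomial_mul, hh.1, one_mul]
  · intro δ hδ hne
    rw [coeff_add] at hδ
    by_cases h1 : coeff δ low = 0
    · rw [h1, add_zero, coeff_monomial_mul', ite_ne_right_iff, one_mul] at hδ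
      obtain ⟨h2, h3⟩ := hδ
      obtain ⟨ε, rfl⟩ := exists_add_of_le h2
      rw [add_tsub_cancel_left] at h3
      rw [add_comm (Finsupp.single t v), map_add, map_add]
      refine add_lt_add_right (hh.2 ε h3 ?_) _
      rintro rfl
      exact hne (add_comm _ _)
    · obtain ⟨i, h2, h3, h4⟩ := hmem (mem_support_iff.2 h1)
      rw [neglex_lt_iff]
      refine ⟨i, by rw [Finsupp.add_apply]; omega, fun j hj => ?_⟩
      rw [h4 j hj, Finsupp.add_apply, Finsupp.single_eq_of_ne (h2.trans hj).ne', zero_add]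

end DemazureExpansion

/-! ### Demazure characters of reverse skip sequences: membership and leading monomial. -/

section DemazureMembership

variable (R : Type*) [CommRing R] [IsDomain R] {n : ℕ}

omit [IsDomain R] in
theorem swapVars_prod_X_pow {p q : Fin n} {A : Finset (Fin n)} (hp : p ∉ A) (hq : q ∉ A)
    (γ : Fin n → ℕ) :
    swapVars p q (∏ i ∈ A, (X i : MvPolynomial (Fin n) R) ^ γ i) = ∏ i ∈ A, X i ^ γ i := by
  rw [map_prod]
  refine Finset.prod_congr rfl fun i hi => ?_
  rw [map_pow, swapVars_X_of_ne (ne_of_mem_of_not_mem hi hp) (ne_of_mem_of_not_mem hi hq)]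

/-- The first `J` positions. -/
def initPos (n J : ℕ) : Finset (Fin n) :=
  Finset.univ.filter fun i => (i : ℕ) < J

theorem mem_initPos {n J : ℕ} {i : Fin n} : i ∈ initPos n J ↔ (i : ℕ) < J := by
  simp [initPos]

theorem initPos_succ {J : ℕ} (p : Fin n) (hp : (p : ℕ) = J) :
    initPos n (J + 1) = insert p (initPos n J) := by
  ext i
  rw [mem_initPos, Finset.mem_insert, mem_initPos, Fin.ext_iff]
  omega

theorem card_initPos {n J : ℕ} (h : J ≤ n) : (initPos n J).card = J := by
  rw [initPos, Fin.card_filter_val_lt, min_eq_right h]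

omit [IsDomain R] in
theorem swapVars_mem_esymm {k : ℕ} (p q : Fin n) :
    ∀ g ∈ {f : MvPolynomial (Fin n) R | ∃ d, n + 1 ≤ d + k ∧ d ≤ n ∧ f = esymm (Fin n) R d},
      swapVars p q g = g := by
  rintro g ⟨d, -, -, rfl⟩
  exact rename_esymm _ _ _ _

theorem ddChain_mem_esymmIdeal {k : ℕ} {x : ℕ → Fin n} {a l : ℕ}
    (hx : Set.InjOn x (Set.Iic (a + l))) {f : MvPolynomial (Fin n) R} (hf : f ∈ esymmIdeal R n k) :
    ddChain x a l f ∈ esymmIdeal R n k := by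
  induction l with
  | zero => exact hf
  | succ l ih =>
    rw [ddChain]
    exact dividedDiff_mem_span (chain_ne hx (by omega) (by omega) (by omega))
      (swapVars_mem_esymm R _ _) (ih (hx.mono (Set.Iic_subset_Iic.2 (by omega))))

/-- Move the entry of `γ` at `t` back to position `J`, with zeros at the other positions from `J`
to `t`. -/
def moveBack (J : ℕ) (t : Fin n) (γ : Fin n → ℕ) (p : Fin n) : ℕ :=
  if (p : ℕ) = J then γ t else if J < (p : ℕ) ∧ p ≤ t then 0 else γ p

theorem moveBack_of_lt {J : ℕ} {t p : Fin n} {γ : Fin n → ℕ} (h : (p : ℕ) < J) :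
    moveBack J t γ p = γ p := by
  rw [moveBack, if_neg h.ne, if_neg (fun h' => absurd h'.1 h.not_gt)]

theorem moveBack_of_gt {J : ℕ} {t p : Fin n} {γ : Fin n → ℕ} (hJ : J ≤ (t : ℕ)) (h : t < p) :
    moveBack J t γ p = γ p := by
  have := Fin.lt_def.1 h
  rw [moveBack, if_neg (by omega), if_neg (fun h' => absurd h (not_lt.2 h'.2))]

theorem moveBack_of_le {J : ℕ} {t p : Fin n} {γ : Fin n → ℕ} (h : J < (p : ℕ)) (h' : p ≤ t) :
    moveBack J t γ p = 0 := by
  rw [moveBack, if_neg h.ne', if_pos ⟨h, h'⟩]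

/-- The entry at t travels from position J across zeros, each crossing being one ascent;
`demazure_of_ascent` permits this particular choice of ascents. The variables before J are inert and
factor out. -/
theorem demazure_eq_mul_isoChain {J l : ℕ} {t : Fin n} (hl : J + l = t) {x : ℕ → Fin n}
    (xval : ∀ c, c ≤ (t : ℕ) → ((x c : Fin n) : ℕ) = c) {γ : Fin n → ℕ} (hγt : 0 < γ t)
    (hγ0 : ∀ p : Fin n, J ≤ (p : ℕ) → p < t → γ p = 0) (f : MvPolynomial (Fin n) R)
    (hf : demazure R (moveBack J t γ) = (∏ i ∈ initPos n J, X i ^ γ i) * f) :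
    demazure R γ = (∏ i ∈ initPos n J, X i ^ γ i) * isoChain x J l f := by
  have hnot : ∀ c, J ≤ c → c ≤ (t : ℕ) → x c ∉ initPos n J := by
    intro c h1 h2
    rw [mem_initPos, xval c h2]
    omega
  have chain : ∀ c, c ≤ l → ∀ δ : Fin n → ℕ,
      (∀ p : Fin n, δ p = if (p : ℕ) = J + c then γ t else if J ≤ (p : ℕ) ∧ p ≤ t then 0 else γ p) →
      demazure R δ = (∏ i ∈ initPos n J, X i ^ γ i) * isoChain x J c f := by
    intro c
    induction c with
    | zero =>
      intro _ δ hδ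
      have : δ = moveBack J t γ := by
        ext p
        rw [hδ, moveBack, add_zero]
        split_ifs <;> omega
      rw [this, hf, isoChain]
    | succ c ihc =>
      intro hc δ hδ
      have hv1 := xval (J + c) (by omega)
      have hv2 := xval (J + c + 1) (by omega)
      have hle1 : x (J + c) ≤ t := Fin.le_def.2 (by omega)
      have hle2 : x (J + c + 1) ≤ t := Fin.le_def.2 (by omega)
      have hne : x (J + c) ≠ x (J + c + 1) := fun h => by
        have := congrArg Fin.val h
        omega
      have d1 : δ (x (J + c)) = 0 := by
        rw [hδ, if_neg (by omega), if_pos ⟨by omega, hle1⟩]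
      have d2 : δ (x (J + c + 1)) = γ t := by
        rw [hδ, if_pos (by omega)]
      rw [demazure_of_ascent δ (x (J + c)) (x (J + c + 1)) (by omega) (by omega),
        ihc (by omega), isobaric_symm_mul hne
          (swapVars_prod_X_pow R (hnot _ (by omega) (by omega)) (hnot _ (by omega) (by omega)) γ)]
      · rfl
      intro p
      rw [Function.comp]
      rcases eq_or_ne p (x (J + c)) with rfl | hp
      · rw [Equiv.swap_apply_left, d2, if_pos hv1]
      rcases eq_or_ne p (x (J + c + 1)) with rfl | hp'
      · rw [Equiv.swap_apply_right, d1, if_neg (by omega), if_pos ⟨by omega, hle2⟩]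
      rw [Equiv.swap_apply_of_ne_of_ne hp hp', hδ]
      rw [ne_eq, Fin.ext_iff] at hp hp'
      rw [if_neg (by omega), if_neg (show ¬(p : ℕ) = J + c by omega)]
  refine chain l le_rfl γ fun p => ?_
  split_ifs with h1 h2
  · rw [Fin.ext (h1.trans hl)]
  · exact hγ0 p h2.1 (lt_of_le_of_ne h2.2 fun e => h1 (e ▸ hl.symm))
  · rfl

/-- The Demazure characters of compositions that are dominated by their first `J` entries and agree
with the reverse skip sequence of `T` from position `J` on. -/
theorem exists_demazure_factor {k : ℕ} (hk : 0 < k) (T : Finset (Fin n)) :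
    ∀ J : ℕ, J + T.card + k = n + 1 → (∀ t ∈ T, J ≤ (t : ℕ)) →
      ∃ g : MvPolynomial (Fin n) R,
        (∀ γ : Fin n → ℕ, (∀ p : Fin n, J ≤ (p : ℕ) → γ p = gapSeq T p) →
          (∀ i j : Fin n, i ≤ j → (i : ℕ) < J → γ j ≤ γ i) →
          demazure R γ = (∏ i ∈ initPos n J, X i ^ γ i) * g) ∧
        (∀ p q : Fin n, J ≤ (p : ℕ) → (p : ℕ) + 1 = q → (∀ t ∈ T, q ≤ t) →
          swapVars p q g = g) ∧
        (∏ i ∈ initPos n J, X i) ^ k * g ∈ esymmIdeal R n k ∧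
        HasLead g (Finsupp.equivFunOnFinite.symm (gapSeq T)) := by
  -- The factor g depends only on T and J, not on the first J entries of γ. That freedom lets the
  -- entry at the new minimum t join the dominating prefix, so that the case J + 1 applies.
  induction T using Finset.induction_on_min with
  | empty =>
    intro J hJ _
    have h0 : gapSeq (∅ : Finset (Fin n)) = 0 := by
      ext p
      simp [gapSeq]
    rw [Finset.card_empty, add_zero] at hJ
    refine ⟨1, ?_, fun _ _ _ _ _ => map_one _, ?_, ?_⟩
    · intro γ h1 h2
      rw [h0] at h1
      rw [demazure_of_antitone, mul_one]
      · refine (Finset.prod_subset (Finset.subset_univ _) fun i _ hi => ?_).symm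
        rw [mem_initPos, not_lt] at hi
        rw [h1 i hi, Pi.zero_apply, pow_zero]
      · intro i j hij
        rcases lt_or_ge (i : ℕ) J with h | h
        · exact h2 i j hij h
        · rw [h1 i h, h1 j (h.trans hij)]
          exact le_rfl
    · rw [mul_one]
      exact prod_X_pow_mem_esymmIdeal R _ (by rw [card_initPos (by omega)]; exact hJ)
    · have h0' : Finsupp.equivFunOnFinite.symm (gapSeq (∅ : Finset (Fin n))) = 0 := by
        ext p
        rw [h0, Finsupp.equivFunOnFinite_symm_apply_apply]
        rfl
      rw [h0']
      refine ⟨by simp, fun δ hδ hne => ?_⟩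
      rw [coeff_one, if_neg hne.symm] at hδ
      exact absurd rfl hδ
  | insert t T ht ih =>
    intro J hJ hJT
    have htT : t ∉ T := fun h => lt_irrefl _ (ht t h)
    rw [Finset.card_insert_of_notMem htT] at hJ
    have hJt : J ≤ (t : ℕ) := hJT t (Finset.mem_insert_self _ _)
    obtain ⟨g, g1, g2, g3, g4⟩ := ih (J + 1) (by omega)
      fun s hs => (Nat.succ_le_of_lt (lt_of_le_of_lt hJt (Fin.lt_def.1 (ht s hs))))
    have hvt := gapSeq_insert_self ht
    set v := gapSeq (insert t T) t with hv
    have hv0 : 0 < v := by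
      rw [hv, gapSeq, if_pos (Finset.mem_insert_self _ _)]
      omega
    obtain ⟨l, hl⟩ := Nat.exists_eq_add_of_le hJt
    have hvk : l + v = k := by omega
    have htn := t.2
    let x : ℕ → Fin n := fun c => if h : c < n then ⟨c, h⟩ else t
    have xval : ∀ c, c ≤ (t : ℕ) → ((x c : Fin n) : ℕ) = c := by
      intro c hc
      simp only [x, dif_pos (lt_of_le_of_lt hc htn)]
    have hxt : x (J + l) = t := Fin.ext (by rw [xval _ (by omega), hl])
    have hx : Set.InjOn x (Set.Iic (J + l)) := by
      intro c hc d hd h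
      rw [Set.mem_Iic] at hc hd
      have := congrArg Fin.val h
      rwa [xval c (by omega), xval d (by omega)] at this
    have hgt : ∀ p : Fin n, p ≤ t → gapSeq T p = 0 := fun p hp => by
      rw [gapSeq, if_neg]
      exact fun h => absurd (ht p h) (not_lt.2 hp)
    have hsym : ∀ c, J + 1 ≤ c → c < J + l → swapVars (x c) (x (c + 1)) (X (x J) ^ v * g) =
        X (x J) ^ v * g := by
      intro c h1 h2
      rw [map_mul, map_pow, swapVars_chain_X hx (by omega) (by omega) (by omega) (by omega),
        g2 _ _ (by rw [xval c (by omega)]; exact h1)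
          (by rw [xval c (by omega), xval (c + 1) (by omega)])]
      intro s hs
      rw [Fin.le_def, xval (c + 1) (by omega)]
      exact le_trans (by omega) (Fin.lt_def.1 (ht s hs)).le
    have hnot : ∀ c, J ≤ c → c ≤ (t : ℕ) → x c ∉ initPos n J := by
      intro c h1 h2
      rw [mem_initPos, xval c h2]
      omega
    have hprod : ∀ γ : Fin n → ℕ, ∏ i ∈ initPos n (J + 1), (X i : MvPolynomial (Fin n) R) ^ γ i =
        X (x J) ^ γ (x J) * ∏ i ∈ initPos n J, X i ^ γ i := fun γ => by
      rw [initPos_succ (x J) (xval J hJt), Finset.prod_insert (hnot J le_rfl hJt)]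
    refine ⟨isoChain x J l (X (x J) ^ v * g), ?_, ?_, ?_, ?_⟩
    · intro γ h1 h2
      have hγv : γ t = v := h1 t hJt
      have hγgt : ∀ p, t < p → γ p = gapSeq T p := fun p hp => by
        rw [h1 p (hJt.trans (Fin.le_def.1 hp.le)), gapSeq_insert_of_lt hp]
      refine demazure_eq_mul_isoChain R hl.symm xval (by omega) (fun p hp hp' => ?_) _ ?_
      · rw [h1 p hp, gapSeq, if_neg]
        rw [Finset.mem_insert, not_or]
        exact ⟨hp'.ne, fun hp => absurd (ht p hp) (not_lt.2 hp'.le)⟩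
      have hJ1 : moveBack J t γ (x J) = v := by
        rw [moveBack, if_pos (xval J hJt), hγv]
      rw [g1, hprod, hJ1]
      · have : ∏ i ∈ initPos n J, (X i : MvPolynomial (Fin n) R) ^ moveBack J t γ i =
            ∏ i ∈ initPos n J, X i ^ γ i :=
          Finset.prod_congr rfl fun i hi => by
            rw [moveBack_of_lt (mem_initPos.1 hi)]
        rw [this]
        ring
      · intro p hp
        rcases le_or_gt p t with h | h
        · rw [moveBack_of_le (by omega) h, hgt p h]
        · rw [moveBack_of_gt hJt h, hγgt p h]
      · intro i j hij hi
        -- The moved entry v dominates everything after t by `gapSeq_le_of_lt`, and the positions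
        -- between J and t are now zero.
        rcases lt_or_ge t j with hj | hj
        · rw [moveBack_of_gt hJt hj]
          rcases lt_or_eq_of_le (Nat.lt_succ_iff.1 hi) with hi | hi
          · rw [moveBack_of_lt hi]
            exact h2 i j hij hi
          · rw [moveBack, if_pos hi, hγgt j hj, hγv, hv]
            exact gapSeq_le_of_lt hj
        · rcases lt_trichotomy (j : ℕ) J with h | h | h
          · rw [moveBack_of_lt h, moveBack_of_lt (lt_of_le_of_lt hij h)]
            exact h2 i j hij (lt_of_le_of_lt hij h)
          · rw [moveBack, if_pos h]
            rcases lt_or_eq_of_le (Nat.lt_succ_iff.1 hi) with hi | hi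
            · rw [moveBack_of_lt hi]
              exact h2 i t (hij.trans hj) hi
            · rw [moveBack, if_pos hi]
          · rw [moveBack_of_le h hj]
            exact Nat.zero_le _
    · intro p q hp hpq hq
      have hqt := Fin.le_def.1 (hq t (Finset.mem_insert_self _ _))
      have e1 : p = x p := Fin.ext (by rw [xval _ (by omega)])
      have e2 : q = x (p + 1) := Fin.ext (by rw [xval _ (by omega), hpq])
      have h := isoChain_symm hx le_rfl hsym hp (by omega)
      rwa [← e1, ← e2] at h
    -- The power x_J^l from the conversion meets the entry x_J^v, and l + v = k. With the prefix
    -- taken inside the chain, its argument is the k-th power of the product of the first J + 1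
    -- variables times g, which lies in the ideal by induction.
    · rw [isoChain_eq_ddChain hx hsym, ← ddChain_symm_mul hx]
      · apply ddChain_mem_esymmIdeal R hx
        have e := hprod 1
        simp only [Pi.one_apply, pow_one] at e
        have hX : (X (x J) : MvPolynomial (Fin n) R) ^ k = X (x J) ^ l * X (x J) ^ v := by
          rw [← pow_add, hvk]
        rw [e, mul_pow, hX] at g3
        convert g3 using 1
        ring
      · intro c h1 h2
        have := swapVars_prod_X_pow R (hnot c h1 (by omega)) (hnot (c + 1) (by omega) (by omega)) 1
        simp only [Pi.one_apply, pow_one] at this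
        rw [map_pow, this]
    · have h := hasLead_isoChain hx (fun c h1 h2 => Fin.le_def.2 (by
        rw [xval c (by omega), xval _ (by omega)]; exact h2)) g4 (fun i hi => hgt i (hxt ▸ hi)) v
      convert h using 1
      ext p
      rw [Finsupp.add_apply, Finsupp.equivFunOnFinite_symm_apply_apply,
        Finsupp.equivFunOnFinite_symm_apply_apply, hxt]
      rcases lt_trichotomy p t with h' | rfl | h'
      · rw [Finsupp.single_eq_of_ne h'.ne, hgt p h'.le, gapSeq, if_neg]
        rw [Finset.mem_insert, not_or]
        exact ⟨h'.ne, fun hp => absurd (ht p hp) (not_lt.2 h'.le)⟩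
      · rw [Finsupp.single_eq_same, hgt p le_rfl, add_zero]
      · rw [Finsupp.single_eq_of_ne h'.ne', gapSeq_insert_of_lt h', zero_add]

theorem revSkipSeq_eq_gapSeq (S : Finset (Fin n)) :
    revSkipSeq S = gapSeq (S.map Fin.revPerm.toEmbedding) := by
  ext t
  have hm : ∀ p : Fin n, p ∈ S.map Fin.revPerm.toEmbedding ↔ p.rev ∈ S := by
    intro p
    rw [Finset.mem_map]
    constructor
    · rintro ⟨a, ha, rfl⟩
      simpa using ha
    · exact fun h => ⟨p.rev, h, by simp⟩
  rw [revSkipSeq, skipSeq, gapSeq]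
  simp only [hm]
  split_ifs with h
  · congr 1
    have h1 : (Finset.univ.filter fun p : Fin n => p.rev ∉ S ∧ t < p).card =
        (Finset.Iic t.rev \ S.filter (· ≤ t.rev)).card := by
      refine Finset.card_bij (fun p _ => p.rev) ?_ (fun a _ b _ hab => Fin.rev_injective hab) ?_
      · intro p hp
        simp only [Finset.mem_filter, Finset.mem_univ, true_and] at hp
        simp only [Finset.mem_sdiff, Finset.mem_Iic, Finset.mem_filter, not_and, Fin.rev_le_rev]
        exact ⟨hp.2.le, fun h => absurd h hp.1⟩
      · intro q hq
        simp only [Finset.mem_sdiff, Finset.mem_Iic, Finset.mem_filter] at hq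
        have hqS : q ∉ S := fun h' => hq.2 ⟨h', hq.1⟩
        refine ⟨q.rev, ?_, Fin.rev_rev q⟩
        simp only [Finset.mem_filter, Finset.mem_univ, true_and, Fin.rev_rev]
        refine ⟨hqS, ?_⟩
        rw [← Fin.rev_lt_rev, Fin.rev_rev]
        exact lt_of_le_of_ne hq.1 fun e => hqS (e ▸ h)
    rw [h1, Finset.card_sdiff_of_subset, Fin.card_Iic]
    intro p hp
    exact Finset.mem_Iic.2 (Finset.mem_filter.1 hp).2
  · rfl

/-- This is `exists_demazure_factor` with empty prefix, where the domination condition is void. -/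
theorem demazure_revSkipSeq {k : ℕ} (hk : 0 < k) (S : Finset (Fin n)) (hS : S.card + k = n + 1) :
    demazure R (revSkipSeq S) ∈ esymmIdeal R n k ∧
      HasLead (demazure R (revSkipSeq S)) (Finsupp.equivFunOnFinite.symm (revSkipSeq S)) := by
  obtain ⟨g, g1, -, g3, g4⟩ := exists_demazure_factor R hk (S.map Fin.revPerm.toEmbedding) 0
    (by rw [Finset.card_map]; omega) fun _ _ => Nat.zero_le _
  have h0 : initPos n 0 = ∅ := by
    ext i
    simp [mem_initPos]
  rw [h0, Finset.prod_empty, one_pow, one_mul] at g3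
  have e := g1 (revSkipSeq S) (fun p _ => by rw [revSkipSeq_eq_gapSeq])
    (fun i j _ h => absurd h (Nat.not_lt_zero _))
  rw [h0, Finset.prod_empty, one_mul] at e
  rw [e, revSkipSeq_eq_gapSeq]
  exact ⟨g3, g4⟩

end DemazureMembership

/-! ### The candidate basis: integrality, membership and leading monomials. -/

section GroebnerSet

theorem map_isobaric {σ R S : Type*} [DecidableEq σ] [CommRing R] [CommRing S] [IsDomain S]
    (φ : R →+* S) {i j : σ} (hij : i ≠ j) (f : MvPolynomial σ R) :
    map φ (isobaric i j f) = isobaric i j (map φ f) := by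
  refine eq_isobaric hij ?_
  have h := congrArg (map φ) (mul_isobaric i j f)
  simp only [map_mul, map_sub, map_X, swapVars, map_rename] at h
  exact h

/-- Integrality of the rational Demazure characters comes from here: the defining identity of each
operator survives a change of coefficients, and exact quotients are unique over a domain. -/
theorem map_demazure {R S : Type*} [CommRing R] [IsDomain R] [CommRing S] [IsDomain S]
    (φ : R →+* S) {n : ℕ} (γ : Fin n → ℕ) : map φ (demazure R γ) = demazure S γ := by
  induction hN : ∑ a : Fin n, (a : ℕ) * γ a using Nat.strong_induction_on generalizing γ with
  | _ N ih =>
    subst hN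
    by_cases h : ∃ p : Fin n × Fin n, (p.1 : ℕ) + 1 = p.2 ∧ γ p.1 < γ p.2
    · obtain ⟨p, h1, h2⟩ := h
      have hne : p.1 ≠ p.2 := fun e => by
        rw [e] at h1
        omega
      rw [demazure_of_ascent γ p.1 p.2 h1 h2, demazure_of_ascent γ p.1 p.2 h1 h2,
        map_isobaric φ hne, ih _ (sum_swap_lt γ p ⟨h1, h2⟩) _ rfl]
    · rw [demazure, dif_neg h, demazure, dif_neg h]
      simp

variable {r n k : ℕ} {α : Fin r → ℕ}

/-- The number of variables before the `i`-th batch. -/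
def batchStart (α : Fin r → ℕ) (i : Fin r) : ℕ :=
  ∑ t ∈ Finset.univ.filter (· < i), α t

theorem mem_batchInit {i : Fin r} {j : ℕ} {p : Fin n} :
    p ∈ batchInit n α i j ↔ batchStart α i ≤ (p : ℕ) ∧ (p : ℕ) < batchStart α i + j := by
  simp [batchInit, batchStart]

theorem batchStart_add_le (i : Fin r) : batchStart α i + α i ≤ ∑ t, α t := by
  have h : batchStart α i + α i = ∑ t ∈ insert i (Finset.univ.filter (· < i)), α t := by
    rw [Finset.sum_insert (by simp), add_comm, batchStart]
  rw [h]
  exact Finset.sum_le_sum_of_subset (Finset.subset_univ _)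

theorem batchStart_add_le_of_lt {i i' : Fin r} (h : i < i') :
    batchStart α i + α i ≤ batchStart α i' := by
  have h' : batchStart α i + α i = ∑ t ∈ insert i (Finset.univ.filter (· < i)), α t := by
    rw [Finset.sum_insert (by simp), add_comm, batchStart]
  rw [h']
  refine Finset.sum_le_sum_of_subset fun t ht => ?_
  rw [Finset.mem_insert, Finset.mem_filter] at ht
  rw [Finset.mem_filter]
  rcases ht with rfl | ht
  · exact ⟨Finset.mem_univ _, h⟩
  · exact ⟨Finset.mem_univ _, ht.2.trans h⟩

theorem batchInit_succ {i : Fin r} {j : ℕ} {p : Fin n} (hp : (p : ℕ) = batchStart α i + j) :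
    batchInit n α i (j + 1) = insert p (batchInit n α i j) := by
  ext q
  rw [Finset.mem_insert, mem_batchInit, mem_batchInit, Fin.ext_iff]
  omega

theorem notMem_batchInit {i : Fin r} {j : ℕ} {p : Fin n} (hp : (p : ℕ) = batchStart α i + j) :
    p ∉ batchInit n α i j := by
  rw [mem_batchInit]
  omega

/-- Variables are removed from the full batch one at a time by h_d(A) = h_d(A ∪ p) - x_p h_{d-1}(A ∪
p). Each removal raises the least admissible degree by one. -/
theorem hsymmOn_batchInit_mem (R : Type*) [CommRing R] (hα : ∀ i, α i ≤ k) (hn : ∑ i, α i = n)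
    (i : Fin r) {j d : ℕ} (hj : j ≤ α i) (hd : k + 1 ≤ d + j) (hdk : d ≤ k) :
    hsymmOn R (batchInit n α i j) d ∈ configIdeal R n α k := by
  induction hj using Nat.decreasingInduction generalizing d with
  | self => exact Ideal.subset_span (Or.inr ⟨i, d, hd, hdk, rfl⟩)
  | of_succ j hj ih =>
    have hle := batchStart_add_le (α := α) i
    have hki := hα i
    obtain ⟨d, rfl⟩ : ∃ d', d = d' + 1 := ⟨d - 1, by omega⟩
    have hp : batchStart α i + j < n := by omega
    have h := hsymmOn_insert (R := R) (notMem_batchInit (α := α) (i := i) (j := j)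
      (p := ⟨batchStart α i + j, hp⟩) rfl) d
    rw [← batchInit_succ rfl] at h
    rw [eq_sub_of_add_eq h.symm]
    exact sub_mem (ih (by omega) hdk) (Ideal.mul_mem_left _ _ (ih (by omega) (by omega)))

theorem esymmIdeal_le_configIdeal (R : Type*) [CommRing R] :
    esymmIdeal R n k ≤ configIdeal R n α k :=
  Ideal.span_mono Set.subset_union_left

theorem groebnerSet_subset (R : Type*) [CommRing R] [IsDomain R] (hk : 0 < k) (hα : ∀ i, α i ≤ k)
    (hn : ∑ i, α i = n) :
    groebnerSet R n α k ⊆ (configIdeal R n α k : Set (MvPolynomial (Fin n) R)) := by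
  rintro f (⟨S, hS, rfl⟩ | ⟨i, j, h1, h2, rfl⟩)
  · exact esymmIdeal_le_configIdeal R (demazure_revSkipSeq R hk S hS).1
  · have := hα i
    exact hsymmOn_batchInit_mem R hα hn i h2 (by omega) (by omega)

theorem hasLead_hsymmOn_batchInit (R : Type*) [CommRing R] {i : Fin r} {j : ℕ} {p : Fin n}
    (hp : (p : ℕ) = batchStart α i + j) (d : ℕ) :
    HasLead (hsymmOn R (batchInit n α i (j + 1)) d) (Finsupp.single p d) := by
  refine hasLead_hsymmOn (mem_batchInit.2 (by omega)) (fun a ha => ?_) d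
  rw [mem_batchInit] at ha
  exact Fin.le_def.2 (by omega)

theorem groebnerSet_hasLead (R : Type*) [CommRing R] [IsDomain R] (hk : 0 < k)
    (hn : ∑ i, α i = n) {f : MvPolynomial (Fin n) R} (hf : f ∈ groebnerSet R n α k) :
    ∃ μ, HasLead f μ := by
  rcases hf with ⟨S, hS, rfl⟩ | ⟨i, j, h1, h2, rfl⟩
  · exact ⟨_, (demazure_revSkipSeq R hk S hS).2⟩
  · obtain ⟨j, rfl⟩ : ∃ j', j = j' + 1 := ⟨j - 1, by omega⟩
    have := batchStart_add_le (α := α) i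
    exact ⟨_, hasLead_hsymmOn_batchInit R (p := ⟨batchStart α i + j, by omega⟩) rfl _⟩

theorem exists_map_eq_of_mem_groebnerSet (hk : 0 < k) (hα : ∀ i, α i ≤ k)
    (hn : ∑ i, α i = n) {g : MvPolynomial (Fin n) ℚ} (hg : g ∈ groebnerSet ℚ n α k) :
    ∃ f : MvPolynomial (Fin n) ℤ, map (Int.castRingHom ℚ) f = g ∧ f ∈ configIdeal ℤ n α k := by
  rcases hg with ⟨S, hS, rfl⟩ | ⟨i, j, h1, h2, rfl⟩
  · exact ⟨demazure ℤ (revSkipSeq S), map_demazure _ _,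
      groebnerSet_subset ℤ hk hα hn (Or.inl ⟨S, hS, rfl⟩)⟩
  · exact ⟨hsymmOn ℤ (batchInit n α i j) (k - j + 1), map_hsymmOn _ _ _,
      groebnerSet_subset ℤ hk hα hn (Or.inr ⟨i, j, h1, h2, rfl⟩)⟩

theorem groebnerSet_finite (R : Type*) [CommRing R] : (groebnerSet R n α k).Finite := by
  refine Set.Finite.union ?_ ?_
  · refine (Set.finite_range fun S : Finset (Fin n) => demazure R (revSkipSeq S)).subset ?_
    rintro f ⟨S, -, rfl⟩
    exact ⟨S, rfl⟩
  · refine (Set.finite_range fun q : (Σ i : Fin r, Fin (α i + 1)) =>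
      hsymmOn R (batchInit n α q.1 q.2) (k - q.2 + 1)).subset ?_
    rintro f ⟨i, j, -, h2, rfl⟩
    exact ⟨⟨i, ⟨j, by omega⟩⟩, rfl⟩

theorem exists_mem_batch (hn : ∑ i, α i = n) (p : Fin n) :
    ∃ i, batchStart α i ≤ (p : ℕ) ∧ (p : ℕ) < batchStart α i + α i := by
  by_contra! h
  have key : ∀ m ≤ r, ∑ t ∈ Finset.univ.filter (fun t : Fin r => (t : ℕ) < m), α t ≤ (p : ℕ) := by
    intro m
    induction m with
    | zero => simp
    | succ m ih =>
      intro hm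
      have h1 := h ⟨m, hm⟩ (ih (by omega))
      refine le_trans (le_of_eq ?_) h1
      have : (Finset.univ.filter fun t : Fin r => (t : ℕ) < m + 1) =
          insert ⟨m, hm⟩ (Finset.univ.filter (· < (⟨m, hm⟩ : Fin r))) := by
        ext t
        simp only [Finset.mem_filter, Finset.mem_univ, true_and, Finset.mem_insert, Fin.ext_iff,
          Fin.lt_def]
        omega
      rw [this, Finset.sum_insert (by simp), add_comm, batchStart]
  have h1 := key r le_rfl
  rw [Finset.filter_true_of_mem fun t _ => t.2, hn] at h1
  exact absurd p.2 (not_lt.2 h1)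

end GroebnerSet

/-! ### Coding exponent vectors by words. -/

section Words

variable {k : ℕ}

/-- The elements outside `U` can be labelled by `0, 1, ..., k - |U| - 1` such that the elements
outside `S` come first. -/
theorem exists_labelling (hk : 0 < k) (S U : Finset (Fin k)) : ∃ c : ℕ → Fin k, U ⊆ S →
    (∀ v, v + U.card < k → c v ∉ U) ∧ (∀ v, v + U.card < k → (c v ∉ S ↔ v + S.card < k)) ∧
      ∀ v w, v + U.card < k → w + U.card < k → c v = c w → v = w := by
  by_cases hUS : U ⊆ S
  swap
  -- The inclusion is a premise inside the existential, so that `choose` yields a labelling for all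
  -- pairs of sets; its values for other pairs do not matter.
  · exact ⟨fun _ => ⟨0, hk⟩, fun h => absurd h hUS⟩
  have h1 : Sᶜ.card + S.card = k := by
    rw [Finset.card_compl_add_card, Fintype.card_fin]
  have h2 : (S \ U).card + U.card = S.card := Finset.card_sdiff_add_card_eq_card hUS
  let c : ℕ → Fin k := fun v =>
    if h : v < Sᶜ.card then Sᶜ.orderEmbOfFin rfl ⟨v, h⟩
    else if h' : v - Sᶜ.card < (S \ U).card then (S \ U).orderEmbOfFin rfl ⟨v - Sᶜ.card, h'⟩
    else ⟨0, hk⟩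
  have c1 : ∀ v (h : v < Sᶜ.card), c v = Sᶜ.orderEmbOfFin rfl ⟨v, h⟩ := fun v h => dif_pos h
  have c2 : ∀ v (_ : ¬ v < Sᶜ.card) (h : v - Sᶜ.card < (S \ U).card),
      c v = (S \ U).orderEmbOfFin rfl ⟨v - Sᶜ.card, h⟩ := fun v h h' => by
    simp only [c]
    rw [dif_neg h, dif_pos h']
  have m1 : ∀ v, v < Sᶜ.card → c v ∉ S := fun v h => by
    rw [c1 v h, ← Finset.mem_compl]
    exact Finset.orderEmbOfFin_mem _ _ _
  have m2 : ∀ v, ¬ v < Sᶜ.card → v + U.card < k → c v ∈ S \ U := fun v h h' => by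
    rw [c2 v h (by omega)]
    exact Finset.orderEmbOfFin_mem _ _ _
  have hS : ∀ v, v + U.card < k → (c v ∉ S ↔ v + S.card < k) := by
    intro v hv
    by_cases h : v < Sᶜ.card
    · exact ⟨fun _ => by omega, fun _ => m1 v h⟩
    · exact ⟨fun h' => absurd (Finset.mem_sdiff.1 (m2 v h hv)).1 h', fun h' => by omega⟩
  refine ⟨c, fun _ => ⟨fun v hv => ?_, hS, fun v w hv hw e => ?_⟩⟩
  · by_cases h : v < Sᶜ.card
    · exact fun h' => m1 v h (hUS h')
    · exact (Finset.mem_sdiff.1 (m2 v h hv)).2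
  · have hvw : v + S.card < k ↔ w + S.card < k := by rw [← hS v hv, ← hS w hw, e]
    by_cases h : v < Sᶜ.card
    · have h' : w < Sᶜ.card := by omega
      rw [c1 v h, c1 w h'] at e
      simpa using e
    · have h' : ¬ w < Sᶜ.card := by omega
      rw [c2 v h (by omega), c2 w h' (by omega)] at e
      have := Fin.mk.inj_iff.1 ((Finset.orderEmbOfFin _ _).injective e)
      omega

/-- The word whose letter at `p` is chosen by `c` from the set of earlier letters, the set of
letters at the positions from `s p` on, and the number `b p`. -/
def codeWord (c : Finset (Fin k) → Finset (Fin k) → ℕ → Fin k) (s b : ℕ → ℕ) (p : ℕ) : Fin k :=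
  c (Finset.univ.image fun q : Fin p => codeWord c s b q)
    ((Finset.univ.filter fun q : Fin p => s p ≤ q).image fun q : Fin p => codeWord c s b q) (b p)
termination_by p
decreasing_by all_goals exact q.2

/-- The letters of `y` at positions in `[s, p)`. -/
def lettersIn (y : ℕ → Fin k) (s p : ℕ) : Finset (Fin k) :=
  (Finset.Ico s p).image y

theorem codeWord_eq (c : Finset (Fin k) → Finset (Fin k) → ℕ → Fin k) (s b : ℕ → ℕ) (p : ℕ) :
    codeWord c s b p =
      c (lettersIn (codeWord c s b) 0 p) (lettersIn (codeWord c s b) (s p) p) (b p) := by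
  conv_lhs => rw [codeWord]
  refine congrFun (congrArg₂ c ?_ ?_) _
  · ext a
    simp only [lettersIn, Finset.mem_image, Finset.mem_univ, true_and, Finset.mem_Ico]
    exact ⟨fun ⟨q, h⟩ => ⟨q, ⟨Nat.zero_le _, q.2⟩, h⟩, fun ⟨q, h, h'⟩ => ⟨⟨q, h.2⟩, h'⟩⟩
  · ext a
    simp only [lettersIn, Finset.mem_image, Finset.mem_univ, true_and, Finset.mem_Ico,
      Finset.mem_filter]
    exact ⟨fun ⟨q, h, h'⟩ => ⟨q, ⟨h, q.2⟩, h'⟩, fun ⟨q, h, h'⟩ => ⟨⟨q, h.2⟩, h.1, h'⟩⟩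

theorem card_lettersIn_le (y : ℕ → Fin k) (s p : ℕ) : (lettersIn y s p).card ≤ p - s :=
  Finset.card_image_le.trans_eq (Nat.card_Ico s p)

theorem lettersIn_subset (y : ℕ → Fin k) (s p : ℕ) : lettersIn y s p ⊆ lettersIn y 0 p :=
  Finset.image_subset_image (Finset.Ico_subset_Ico_left (Nat.zero_le s))

theorem lettersIn_congr {y z : ℕ → Fin k} {s p : ℕ} (h : ∀ q < p, y q = z q) :
    lettersIn y s p = lettersIn z s p :=
  Finset.image_congr fun q hq => h q (Finset.mem_Ico.1 hq).2

theorem lettersIn_eq_image_new (y : ℕ → Fin k) (p : ℕ) :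
    lettersIn y 0 p = ((Finset.range p).filter fun q => y q ∉ lettersIn y 0 q).image y := by
  apply Finset.Subset.antisymm
  · intro a ha
    rw [lettersIn, Finset.mem_image] at ha
    have hex : ∃ q, y q = a := ha.imp fun _ h => h.2
    have hmin : ∀ m < Nat.find hex, y m ≠ a := fun m hm => Nat.find_min hex hm
    refine Finset.mem_image.2 ⟨Nat.find hex, Finset.mem_filter.2 ⟨?_, ?_⟩, Nat.find_spec hex⟩
    · obtain ⟨q, hq, hqa⟩ := ha
      exact Finset.mem_range.2 (lt_of_le_of_lt (Nat.find_min' hex hqa) (Finset.mem_Ico.1 hq).2)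
    · intro h
      rw [lettersIn, Finset.mem_image, Nat.find_spec hex] at h
      obtain ⟨q, hq, hqa⟩ := h
      exact hmin q (Finset.mem_Ico.1 hq).2 hqa
  · refine Finset.image_subset_image fun q hq => ?_
    rw [Finset.mem_filter, Finset.mem_range] at hq
    exact Finset.mem_Ico.2 ⟨Nat.zero_le _, hq.1⟩

/-- Letters are counted by their first occurrences. -/
theorem card_new_eq (y : ℕ → Fin k) (p : ℕ) :
    ((Finset.range p).filter fun q => y q ∉ lettersIn y 0 q).card = (lettersIn y 0 p).card := by
  rw [lettersIn_eq_image_new y p, Finset.card_image_of_injOn]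
  have key : ∀ q q', q < q' → y q' ∉ lettersIn y 0 q' → y q ≠ y q' := fun q q' h h' e =>
    h' (Finset.mem_image.2 ⟨q, Finset.mem_Ico.2 ⟨Nat.zero_le _, h⟩, e⟩)
  intro q hq q' hq' e
  rw [Finset.mem_coe, Finset.mem_filter] at hq hq'
  rcases lt_trichotomy q q' with h | h | h
  · exact absurd e (key q q' h hq'.2)
  · exact h
  · exact absurd e.symm (key q' q h hq.2)

/-- Exponent vectors in a box encode words; the word uses all letters when the monomial is not
divisible by any of the monomials `x ^ gapSeq T`. -/
theorem exists_words {n : ℕ} (hk : 0 < k) (hkn : k ≤ n + 1) (s : ℕ → ℕ) :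
    ∃ w : (Fin n →₀ ℕ) → Fin n → Fin k, ∀ b : Fin n →₀ ℕ,
      (∀ p : Fin n, b p + (p - s p) < k) →
        (∀ q p : Fin n, q < p → s p ≤ q → w b q ≠ w b p) ∧
        (∀ b' : Fin n →₀ ℕ, (∀ p : Fin n, b' p + (p - s p) < k) → w b = w b' → b = b') ∧
        ((∀ T : Finset (Fin n), T.card + k = n + 1 → ∃ t ∈ T, b t < gapSeq T t) →
          Function.Surjective (w b)) := by
  -- The letter at p avoids the earlier letters of its block, and b p selects among the rest with
  -- unused letters first. So a letter is new exactly when b p is less than the number of unused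
  -- letters, and b can be read back from the word.
  choose c hc using exists_labelling hk
  let e : (Fin n →₀ ℕ) → ℕ → ℕ := fun b p => if h : p < n then b ⟨p, h⟩ else 0
  have he : ∀ b (p : Fin n), e b p = b p := fun b p => dif_pos p.2
  let y : (Fin n →₀ ℕ) → ℕ → Fin k := fun b => codeWord c s (e b)
  have hy : ∀ b (p : Fin n), y b p = c (lettersIn (y b) 0 p) (lettersIn (y b) (s p) p) (b p) := by
    intro b p
    rw [← he b p]
    exact codeWord_eq c s (e b) p
  refine ⟨fun b p => y b p, fun b hb => ?_⟩
  have hbox : ∀ b : Fin n →₀ ℕ, (∀ p : Fin n, b p + (p - s p) < k) → ∀ p : Fin n,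
      b p + (lettersIn (y b) (s p) p).card < k := fun b hb p =>
    lt_of_le_of_lt (Nat.add_le_add_left (card_lettersIn_le _ _ _) _) (hb p)
  refine ⟨fun q p hqp hsq h => ?_, fun b' hb' h => ?_, fun hT => ?_⟩
  · have h1 := (hc _ _ (lettersIn_subset (y b) (s p) p)).1 (b p) (hbox b hb p)
    rw [← hy] at h1
    exact h1 (Finset.mem_image.2 ⟨q, Finset.mem_Ico.2 ⟨hsq, hqp⟩, h⟩)
  · have h' : ∀ q < n, y b q = y b' q := fun q hq => congrFun h ⟨q, hq⟩
    ext p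
    have e1 : ∀ a, lettersIn (y b') a p = lettersIn (y b) a p := fun a =>
      lettersIn_congr fun q hq => (h' q (hq.trans p.2)).symm
    have h2 := h' p p.2
    have h3 := hbox b' hb' p
    rw [hy, hy, e1, e1] at h2
    rw [e1] at h3
    exact (hc _ _ (lettersIn_subset (y b) (s p) p)).2.2 _ _ (hbox b hb p) h3 h2
  · by_contra hns
    have hnew : ∀ p : Fin n, y b p ∉ lettersIn (y b) 0 p ↔ b p + (lettersIn (y b) 0 p).card < k := by
      intro p
      have := (hc _ _ (lettersIn_subset (y b) (s p) p)).2.1 (b p) (hbox b hb p)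
      rwa [← hy] at this
    have hlt : (lettersIn (y b) 0 n).card < k := by
      by_contra hge
      apply hns
      intro a
      have hu : lettersIn (y b) 0 n = Finset.univ := by
        apply Finset.eq_univ_of_card
        rw [Fintype.card_fin]
        exact le_antisymm (card_finset_fin_le _) (not_lt.1 hge)
      have ha : a ∈ lettersIn (y b) 0 n := hu ▸ Finset.mem_univ a
      obtain ⟨q, hq, hqa⟩ := Finset.mem_image.1 ha
      exact ⟨⟨q, (Finset.mem_Ico.1 hq).2⟩, hqa⟩
    have hcard : ∀ p ≤ n, (Finset.univ.filter fun q : Fin n => (q : ℕ) < p ∧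
        y b q ∉ lettersIn (y b) 0 q).card = (lettersIn (y b) 0 p).card := by
      intro p hp
      rw [← card_new_eq]
      refine Finset.card_bij (fun q _ => (q : ℕ)) ?_ (fun _ _ _ _ h => Fin.ext h) ?_
      · intro q hq
        rw [Finset.mem_filter] at hq
        exact Finset.mem_filter.2 ⟨Finset.mem_range.2 hq.2.1, hq.2.2⟩
      · intro q hq
        rw [Finset.mem_filter, Finset.mem_range] at hq
        exact ⟨⟨q, hq.1.trans_le hp⟩, Finset.mem_filter.2 ⟨Finset.mem_univ _, hq⟩, rfl⟩
    set N := Finset.univ.filter fun q : Fin n => y b q ∉ lettersIn (y b) 0 q with hN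
    have hNcard : N.card < k := by
      have := hcard n le_rfl
      simp only [Fin.is_lt, true_and] at this
      rw [hN, this]
      exact hlt
    have hNc : n + 1 - k ≤ Nᶜ.card := by
      rw [Finset.card_compl, Fintype.card_fin]
      omega
    -- With fewer than k first occurrences, at least n - k + 1 positions carry repeated letters. At
    -- every t in such a T, the letters seen before t number at most the positions outside T before
    -- t; as k - 1 positions lie outside T, repetition forces b t ≥ `gapSeq T t`.
    obtain ⟨T, hTN, hTc⟩ := Finset.exists_subset_card_eq hNc
    obtain ⟨t, htT, hbt⟩ := hT T (by omega)
    have htN : t ∉ N := Finset.mem_compl.1 (hTN htT)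
    have h1 : ¬ b t + (lettersIn (y b) 0 t).card < k := by
      rw [← hnew]
      exact fun h => htN (Finset.mem_filter.2 ⟨Finset.mem_univ _, h⟩)
    have h2 : (lettersIn (y b) 0 t).card ≤ (Finset.univ.filter fun q => q ∉ T ∧ q < t).card := by
      rw [← hcard t t.2.le]
      refine Finset.card_le_card fun q hq => ?_
      rw [Finset.mem_filter] at hq ⊢
      refine ⟨hq.1, fun h => ?_, hq.2.1⟩
      exact Finset.mem_compl.1 (hTN h) (Finset.mem_filter.2 ⟨Finset.mem_univ _, hq.2.2⟩)
    have h3 : (Finset.univ.filter fun q => q ∉ T ∧ q < t).card +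
        (Finset.univ.filter fun q => q ∉ T ∧ t < q).card = Tᶜ.card := by
      rw [← Finset.card_union_of_disjoint]
      · congr 1
        ext q
        simp only [Finset.mem_union, Finset.mem_filter, Finset.mem_univ, true_and,
          Finset.mem_compl]
        constructor
        · rintro (h | h) <;> exact h.1
        · intro h
          rcases lt_trichotomy q t with h' | rfl | h'
          · exact Or.inl ⟨h, h'⟩
          · exact absurd htT h
          · exact Or.inr ⟨h, h'⟩
      · rw [Finset.disjoint_left]
        intro q hq hq'
        exact lt_asymm (Finset.mem_filter.1 hq).2.2 (Finset.mem_filter.1 hq').2.2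
    rw [gapSeq, if_pos htT] at hbt
    rw [Finset.card_compl, Fintype.card_fin] at h3
    omega

end Words

/-! ### Reduction of monomials modulo functions vanishing on a finite set of points. -/

section OrbitHarmonics

variable {σ K A : Type*} [Field K] [CommRing A] [Algebra K A]

/-- Exponents ordered by degree first, then by the monomial order `m`. -/
def gradedRank (m : MonomialOrder σ) (b : σ →₀ ℕ) : ℕ ×ₗ m.syn :=
  toLex (b.degree, m.toSyn b)

theorem gradedRank_add_lt {m : MonomialOrder σ} {a b : σ →₀ ℕ} (c : σ →₀ ℕ)
    (h : gradedRank m a < gradedRank m b) : gradedRank m (c + a) < gradedRank m (c + b) := by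
  rw [gradedRank, gradedRank, Prod.Lex.lt_iff] at h ⊢
  simp only [ofLex_toLex, map_add] at h ⊢
  rcases h with h | ⟨h1, h2⟩
  · exact Or.inl (by omega)
  · exact Or.inr ⟨by omega, add_lt_add_right h2 _⟩

/-- Polynomials that agree on the points `ev` with a polynomial with exponents in `s`. -/
def reducible (ev : MvPolynomial σ K →ₐ[K] A) (s : Set (σ →₀ ℕ)) :
    Submodule K (MvPolynomial σ K) :=
  restrictSupport K s ⊔ LinearMap.ker ev.toLinearMap

theorem mem_reducible {ev : MvPolynomial σ K →ₐ[K] A} {s : Set (σ →₀ ℕ)} {f : MvPolynomial σ K} :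
    f ∈ reducible ev s ↔ ∃ g ∈ restrictSupport K s, ev f = ev g := by
  rw [reducible, Submodule.mem_sup]
  constructor
  · rintro ⟨g, hg, z, hz, rfl⟩
    refine ⟨g, hg, ?_⟩
    rw [map_add, (show ev z = 0 from hz), add_zero]
  · rintro ⟨g, hg, h⟩
    refine ⟨g, hg, f - g, ?_, by ring⟩
    rw [LinearMap.mem_ker]
    change ev (f - g) = 0
    rw [map_sub, h, sub_self]

theorem reducible_mono {ev : MvPolynomial σ K →ₐ[K] A} {s t : Set (σ →₀ ℕ)} (h : s ⊆ t) :
    reducible ev s ≤ reducible ev t := by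
  refine sup_le_sup_right ?_ _
  intro f hf
  rw [mem_restrictSupport_iff] at hf ⊢
  exact hf.trans h

theorem monomial_mem_restrictSupport {s : Set (σ →₀ ℕ)} {b : σ →₀ ℕ} (hb : b ∈ s) (a : K) :
    monomial b a ∈ restrictSupport K s := by
  rw [mem_restrictSupport_iff]
  intro c hc
  have := support_monomial_subset hc
  rw [Finset.mem_singleton] at this
  rwa [this]

theorem restrictSupport_le_of_monomial {s : Set (σ →₀ ℕ)} {W : Submodule K (MvPolynomial σ K)}
    (h : ∀ b ∈ s, monomial b 1 ∈ W) : restrictSupport K s ≤ W := by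
  intro f hf
  rw [mem_restrictSupport_iff] at hf
  rw [f.as_sum]
  refine Submodule.sum_mem _ fun b hb => ?_
  have e : monomial b (coeff b f) = coeff b f • monomial b (1 : K) := by
    rw [smul_monomial, smul_eq_mul, mul_one]
  rw [e]
  exact W.smul_mem _ (h b (hf hb))

theorem reducible_le_of_monomial {ev : MvPolynomial σ K →ₐ[K] A} {s t : Set (σ →₀ ℕ)}
    (h : ∀ b ∈ s, monomial b 1 ∈ reducible ev t) : reducible ev s ≤ reducible ev t :=
  sup_le (restrictSupport_le_of_monomial h) le_sup_right

theorem monomial_mul_mem_reducible {ev : MvPolynomial σ K →ₐ[K] A} {s t : Set (σ →₀ ℕ)}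
    {c : σ →₀ ℕ} (h : ∀ b ∈ s, c + b ∈ t) {f : MvPolynomial σ K} (hf : f ∈ reducible ev s) :
    monomial c 1 * f ∈ reducible ev t := by
  obtain ⟨g, hg, e⟩ := mem_reducible.1 hf
  refine mem_reducible.2 ⟨monomial c 1 * g, ?_, by rw [map_mul, map_mul, e]⟩
  have h' : restrictSupport K s ≤
      (restrictSupport K t).comap (LinearMap.mulLeft K (monomial c (1 : K))) := by
    refine restrictSupport_le_of_monomial fun b hb => ?_
    rw [Submodule.mem_comap, LinearMap.mulLeft_apply, monomial_mul, one_mul]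
    exact monomial_mem_restrictSupport (h b hb) 1
  exact h' hg

/-- The homogeneous components of the elements of an ideal are reducible to lower degree if this
holds for homogeneous generators. -/
theorem homogeneousComponent_mem_reducible {ev : MvPolynomial σ K →ₐ[K] A}
    {F : Set (MvPolynomial σ K)}
    (hF : ∀ g ∈ F, ∃ d, g.IsHomogeneous d ∧ g ∈ reducible ev {b | b.degree < d})
    {f : MvPolynomial σ K} (hf : f ∈ Ideal.span F) (d : ℕ) :
    homogeneousComponent d f ∈ reducible ev {b | b.degree < d} := by
  induction hf using Submodule.span_induction generalizing d with
  | mem g hg =>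
    obtain ⟨d', h1, h2⟩ := hF g hg
    rw [homogeneousComponent_of_mem h1]
    split_ifs with h
    · exact h ▸ h2
    · exact zero_mem _
  | zero => rw [map_zero]; exact zero_mem _
  | add f g _ _ h1 h2 => rw [map_add]; exact add_mem (h1 d) (h2 d)
  | smul a f _ h =>
    rw [smul_eq_mul]
    -- The bound is multiplied by one variable at a time, which shifts component and degree by one;
    -- hence the induction over all d at once.
    clear * - h
    induction a using MvPolynomial.induction_on generalizing d with
    | C c =>
      rw [C_mul', map_smul]
      exact Submodule.smul_mem _ _ (h d)
    | add a b ha hb => rw [add_mul, map_add]; exact add_mem (ha d) (hb d)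
    | mul_X a i ha =>
      rw [mul_right_comm]
      cases d with
      | zero =>
        classical
        rw [homogeneousComponent_zero, coeff_mul_X', if_neg (by simp), C_0]
        exact zero_mem _
      | succ d =>
        have e : homogeneousComponent (d + 1) (a * f * X i) =
            monomial (Finsupp.single i 1) 1 * homogeneousComponent d (a * f) := by
          classical
          ext b
          rw [← X, mul_comm (X i), coeff_homogeneousComponent, coeff_mul_X', coeff_mul_X',
            coeff_homogeneousComponent]
          by_cases hb : i ∈ b.support
          · rw [if_pos hb, if_pos hb]
            have hb' : Finsupp.single i 1 ≤ b := by
              simpa [Nat.one_le_iff_ne_zero] using hb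
            obtain ⟨c, rfl⟩ := exists_add_of_le hb'
            rw [add_tsub_cancel_left, map_add, Finsupp.degree_single]
            congr 1
            rw [eq_iff_iff]
            omega
          · rw [if_neg hb, if_neg hb, ite_self]
        rw [e]
        refine monomial_mul_mem_reducible (fun b hb => ?_) (ha d)
        rw [Set.mem_ofPred_eq] at hb ⊢
        rw [map_add, Finsupp.degree_single]
        omega

/-- The monomials sharing the component of the leading one have the same degree and are smaller for
m; the component itself reduces to lower degree. As m need not respect degree, the rank must compare
degrees first. -/
theorem leadingMonomial_mem_reducible (m : MonomialOrder σ) {ev : MvPolynomial σ K →ₐ[K] A}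
    {f : MvPolynomial σ K} (hf0 : f ≠ 0)
    (hf : ∀ d, homogeneousComponent d f ∈ reducible ev {b | b.degree < d}) :
    monomial (m.degree f) 1 ∈ reducible ev {b | gradedRank m b < gradedRank m (m.degree f)} := by
  classical
  set b := m.degree f with hb
  have h1 := hf b.degree
  have h2 : reducible ev {c | c.degree < b.degree} ≤
      reducible ev {c | gradedRank m c < gradedRank m b} :=
    reducible_mono fun c hc => by
      rw [Set.mem_ofPred_eq, gradedRank, gradedRank, Prod.Lex.lt_iff]
      exact Or.inl hc
  have hc : coeff b f ≠ 0 := MonomialOrder.coeff_degree_ne_zero_iff.2 hf0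
  have h3 : homogeneousComponent b.degree f - coeff b f • monomial b 1 ∈
      restrictSupport K {c | gradedRank m c < gradedRank m b} := by
    rw [mem_restrictSupport_iff]
    intro c hc
    rw [Finset.mem_coe, mem_support_iff, coeff_sub, coeff_smul, coeff_monomial,
      coeff_homogeneousComponent] at hc
    rw [Set.mem_ofPred_eq, gradedRank, gradedRank, Prod.Lex.lt_iff]
    have hcb : b ≠ c := by
      rintro rfl
      simp at hc
    rw [if_neg hcb, smul_zero, sub_zero, ite_ne_right_iff] at hc
    refine Or.inr ⟨hc.1, ?_⟩
    exact lt_of_le_of_ne (MonomialOrder.le_degree (mem_support_iff.2 hc.2))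
      fun e => hcb (m.toSyn.injective e).symm
  have h4 : coeff b f • monomial b (1 : K) ∈
      reducible ev {c | gradedRank m c < gradedRank m b} := by
    have := sub_mem (h2 h1) (Submodule.mem_sup_left h3)
    rwa [sub_sub_cancel] at this
  exact (Submodule.smul_mem_iff _ hc).1 h4

/-- Reduction to standard monomials, modulo the polynomials vanishing under `ev`. -/
theorem monomial_mem_reducible_standard (m : MonomialOrder σ) {ev : MvPolynomial σ K →ₐ[K] A}
    {Λ : Set (σ →₀ ℕ)}
    (hΛ : ∀ b ∈ Λ, monomial b 1 ∈ reducible ev {c | gradedRank m c < gradedRank m b})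
    (b : σ →₀ ℕ) : monomial b 1 ∈
      reducible ev {c | (∀ a ∈ Λ, ¬ a ≤ c) ∧ gradedRank m c ≤ gradedRank m b} := by
  induction b using (InvImage.wf (gradedRank m) wellFounded_lt).induction with
  | _ b ih =>
    by_cases hb : ∀ a ∈ Λ, ¬ a ≤ b
    · refine Submodule.mem_sup_left (monomial_mem_restrictSupport ?_ 1)
      exact ⟨hb, le_rfl⟩
    · push Not at hb
      obtain ⟨a, ha, hab⟩ := hb
      obtain ⟨c, rfl⟩ := exists_add_of_le hab
      rw [add_comm] at ih ⊢
      have h1 : monomial (c + a) (1 : K) = monomial c 1 * monomial a 1 := by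
        rw [monomial_mul, one_mul]
      have h2 : monomial (c + a) 1 ∈ reducible ev {d | gradedRank m d < gradedRank m (c + a)} := by
        rw [h1]
        exact monomial_mul_mem_reducible (fun d hd => gradedRank_add_lt c hd) (hΛ a ha)
      refine reducible_le_of_monomial (fun d hd => ?_) h2
      refine reducible_mono ?_ (ih d hd)
      exact fun e he => ⟨he.1, he.2.trans (le_of_lt hd)⟩

/-- A set `Λ` of exponents that are reducible and whose standard monomials are at most as many as
the points contains a divisor of every reducible exponent. -/
theorem exists_le_of_monomial_mem_reducible {ι : Type*} [Fintype ι] (m : MonomialOrder σ)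
    {ev : MvPolynomial σ K →ₐ[K] (ι → K)} (hev : Function.Surjective ev) {Λ : Set (σ →₀ ℕ)}
    (hΛ : ∀ b ∈ Λ, monomial b 1 ∈ reducible ev {c | gradedRank m c < gradedRank m b})
    (φ : {b : σ →₀ ℕ // ∀ a ∈ Λ, ¬ a ≤ b} → ι) (hφ : Function.Injective φ) {b : σ →₀ ℕ}
    (hb : monomial b 1 ∈ reducible ev {c | gradedRank m c < gradedRank m b}) :
    ∃ a ∈ Λ, a ≤ b := by
  classical
  by_contra hstd
  push Not at hstd
  set s : Set (σ →₀ ℕ) := {b | ∀ a ∈ Λ, ¬ a ≤ b} with hs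
  have hred : ∀ b, monomial b 1 ∈
      reducible ev {c | c ∈ s ∧ gradedRank m c ≤ gradedRank m b} :=
    monomial_mem_reducible_standard m hΛ
  have hfin : Finite s := Finite.of_injective φ hφ
  have := Fintype.ofFinite s
  let T : restrictSupport K s →ₗ[K] (ι → K) := ev.toLinearMap.domRestrict (restrictSupport K s)
  have hT : Function.Surjective T := by
    intro v
    obtain ⟨f, rfl⟩ := hev v
    have hf : f ∈ reducible ev s := by
      refine restrictSupport_le_of_monomial (s := Set.univ) (fun b _ => ?_) ?_
      · exact reducible_mono (fun c hc => hc.1) (hred b)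
      · rw [mem_restrictSupport_iff]
        exact Set.subset_univ _
    obtain ⟨g, hg, e⟩ := mem_reducible.1 hf
    exact ⟨⟨g, hg⟩, e.symm⟩
  have hfd : Module.Finite K (restrictSupport K s) :=
    Module.Finite.of_basis (basisRestrictSupport K s)
  have hdim : Module.finrank K (restrictSupport K s) = Module.finrank K (ι → K) := by
    apply le_antisymm
    · rw [Module.finrank_eq_card_basis (basisRestrictSupport K s), Module.finrank_fintype_fun_eq_card]
      exact Fintype.card_le_of_injective φ hφ
    · exact LinearMap.finrank_le_finrank_of_surjective hT
  have hinj : Function.Injective T :=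
    (LinearMap.injective_iff_surjective_of_finrank_eq_finrank hdim).2 hT
  -- If b were standard, full reduction would express it on the points by standard monomials of
  -- strictly smaller rank. The spanning and the count make standard monomials linearly independent
  -- as functions, a contradiction.
  have hb' : monomial b 1 ∈ reducible ev {c | c ∈ s ∧ gradedRank m c < gradedRank m b} := by
    refine reducible_le_of_monomial (fun c hc => ?_) hb
    refine reducible_mono ?_ (hred c)
    exact fun d hd => ⟨hd.1, hd.2.trans_lt hc⟩
  obtain ⟨g, hg, e⟩ := mem_reducible.1 hb'
  rw [mem_restrictSupport_iff] at hg
  have hgs : g ∈ restrictSupport K s := by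
    rw [mem_restrictSupport_iff]
    exact fun c hc => (hg hc).1
  have hbs : monomial b (1 : K) ∈ restrictSupport K s := monomial_mem_restrictSupport (show b ∈ s from hstd) 1
  have heq : (⟨monomial b 1, hbs⟩ : restrictSupport K s) = ⟨g, hgs⟩ := hinj e
  have heq' : monomial b (1 : K) = g := congrArg Subtype.val heq
  have : b ∈ g.support := by
    rw [← heq', mem_support_iff, coeff_monomial, if_pos rfl]
    exact one_ne_zero
  exact lt_irrefl _ (hg this).2

end OrbitHarmonics

/-! ### Evaluation at points and recursions from power series. -/

section Points

variable {σ ι K : Type*} [Field K]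

/-- Evaluation of polynomials at a family of points. -/
def evalPoints (pt : ι → σ → K) : MvPolynomial σ K →ₐ[K] (ι → K) :=
  AlgHom.pi fun y => aeval (pt y)

theorem evalPoints_apply (pt : ι → σ → K) (f : MvPolynomial σ K) (y : ι) :
    evalPoints pt f y = aeval (pt y) f := rfl

/-- Lagrange interpolation, each pair of distinct points being separated by a linear polynomial in
one coordinate. -/
theorem evalPoints_surjective [Fintype ι] {pt : ι → σ → K} (hpt : Function.Injective pt) :
    Function.Surjective (evalPoints pt) := by
  classical
  have hne : ∀ y z : ι, z ≠ y → ∃ f : MvPolynomial σ K, aeval (pt y) f = 1 ∧ aeval (pt z) f = 0 := by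
    intro y z h
    obtain ⟨p, hp⟩ := Function.ne_iff.1 (hpt.ne h)
    have h0 : pt y p - pt z p ≠ 0 := sub_ne_zero.2 hp.symm
    refine ⟨C (pt y p - pt z p)⁻¹ * (X p - C (pt z p)), ?_, ?_⟩
    · simp [inv_mul_cancel₀ h0]
    · simp
  choose! f hf using hne
  intro v
  refine ⟨∑ y, C (v y) * ∏ z ∈ Finset.univ.erase y, f y z, funext fun z => ?_⟩
  rw [evalPoints_apply, map_sum, Finset.sum_eq_single z]
  · rw [map_mul, map_prod, Finset.prod_eq_one, mul_one, aeval_C]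
    · rfl
    · intro x hx
      exact (hf z x (Finset.ne_of_mem_erase hx)).1
  · intro y _ hy
    rw [map_mul, map_prod, Finset.prod_eq_zero (Finset.mem_erase.2 ⟨hy.symm, Finset.mem_univ z⟩)
      (hf y z hy.symm).2, mul_zero]
  · exact fun h => absurd (Finset.mem_univ z) h

theorem coeff_prod_one_add_C_mul_X {τ : Type*} (s : Finset τ) (a : τ → K) (d : ℕ) :
    PowerSeries.coeff d (∏ i ∈ s, (1 + PowerSeries.C (a i) * PowerSeries.X)) =
      ∑ t ∈ s.powersetCard d, ∏ i ∈ t, a i := by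
  classical
  rw [Finset.prod_one_add, map_sum]
  have h : ∀ t : Finset τ, PowerSeries.coeff d (∏ i ∈ t, (PowerSeries.C (a i) * PowerSeries.X)) =
      if t.card = d then ∏ i ∈ t, a i else 0 := by
    intro t
    rw [Finset.prod_mul_distrib, Finset.prod_const, ← map_prod, PowerSeries.coeff_C_mul,
      PowerSeries.coeff_X_pow, mul_ite, mul_one, mul_zero]
    simp only [eq_comm]
  simp only [h]
  rw [← Finset.sum_filter, Finset.powersetCard_eq_filter]

theorem coeff_prod_one_add_eq_zero {τ : Type*} {s : Finset τ} (a : τ → K) {d : ℕ}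
    (h : s.card < d) :
    PowerSeries.coeff d (∏ i ∈ s, (1 + PowerSeries.C (a i) * PowerSeries.X)) = 0 := by
  rw [coeff_prod_one_add_C_mul_X, Finset.powersetCard_eq_empty.2 h, Finset.sum_empty]

theorem constantCoeff_prod_one_add {τ : Type*} (s : Finset τ) (a : τ → K) :
    PowerSeries.constantCoeff (∏ i ∈ s, (1 + PowerSeries.C (a i) * PowerSeries.X)) = 1 := by
  simp [map_prod]

/-- A homogeneous polynomial `u d` is reducible to lower degree if a linear recursion with constant
coefficients for `u` holds on the points. -/
theorem mem_reducible_of_series {pt : ι → σ → K} {u : ℕ → MvPolynomial σ K}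
    (hu : ∀ e, (u e).IsHomogeneous e) {c : PowerSeries K} (hc : PowerSeries.constantCoeff c = 1)
    {d : ℕ} (h : ∀ y, PowerSeries.coeff d
      (c * PowerSeries.mk fun e => aeval (pt y) (u e)) = 0) :
    u d ∈ reducible (evalPoints pt) {b | b.degree < d} := by
  refine mem_reducible.2
    ⟨-∑ i ∈ Finset.range d, PowerSeries.coeff (i + 1) c • u (d - (i + 1)), ?_, ?_⟩
  · refine neg_mem (Submodule.sum_mem _ fun i hi => Submodule.smul_mem _ _ ?_)
    rw [Finset.mem_range] at hi
    rw [mem_restrictSupport_iff]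
    intro b hb
    have h1 : b.degree = d - (i + 1) :=
      (DFunLike.congr_fun Finsupp.degree_eq_weight_one b).trans
        (hu (d - (i + 1)) (mem_support_iff.1 hb))
    rw [Set.mem_ofPred_eq]
    omega
  · funext y
    have h' := h y
    rw [PowerSeries.coeff_mul, Finset.Nat.sum_antidiagonal_eq_sum_range_succ_mk,
      Finset.sum_range_succ'] at h'
    simp only [PowerSeries.coeff_mk, Nat.sub_zero, PowerSeries.coeff_zero_eq_constantCoeff_apply,
      hc, one_mul] at h'
    rw [evalPoints_apply, evalPoints_apply, map_neg, map_sum]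
    simp only [map_smul, smul_eq_mul]
    exact eq_neg_of_add_eq_zero_right h'

end Points

/-! ### The points given by words, and the Gröbner basis property. -/

section ConfigPoints

variable {r n k : ℕ} {α : Fin r → ℕ}

/-- The point with coordinates `y p`. -/
def wordPoint (y : Fin n → Fin k) (p : Fin n) : ℚ :=
  ((y p : ℕ) : ℚ)

theorem wordPoint_injective : Function.Injective (wordPoint : (Fin n → Fin k) → Fin n → ℚ) := by
  intro y z h
  funext p
  have := congrFun h p
  exact Fin.ext (Nat.cast_injective this)

theorem isHomogeneous_hsymmOn (A : Finset (Fin n)) (d : ℕ) :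
    (hsymmOn ℚ A d).IsHomogeneous d := by
  intro b hb
  rw [coeff_hsymmOn, ite_ne_right_iff] at hb
  exact (DFunLike.congr_fun Finsupp.degree_eq_weight_one b).symm.trans hb.1.2

theorem isHomogeneous_esymm (d : ℕ) : (esymm (Fin n) ℚ d).IsHomogeneous d := by
  refine IsHomogeneous.sum _ _ _ fun t ht => ?_
  have h := IsHomogeneous.prod t (fun i => (X i : MvPolynomial (Fin n) ℚ)) (fun _ => 1)
    fun i _ => isHomogeneous_X ℚ i
  rwa [Finset.sum_const, smul_eq_mul, mul_one, (Finset.mem_powersetCard.1 ht).2] at h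

theorem prod_one_sub_mul_series (x : Fin n → ℚ) (A : Finset (Fin n)) :
    (∏ p ∈ A, (1 + PowerSeries.C (-x p) * PowerSeries.X)) *
      PowerSeries.mk (fun e => aeval x (hsymmOn ℚ A e)) = 1 := by
  induction A using Finset.induction_on with
  | empty =>
    rw [Finset.prod_empty, one_mul]
    ext d
    rw [PowerSeries.coeff_mk, PowerSeries.coeff_one]
    cases d with
    | zero => rw [hsymmOn_zero, map_one, if_pos rfl]
    | succ d => rw [hsymmOn_empty, map_zero, if_neg (Nat.succ_ne_zero d)]
  | insert p A hp ih =>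
    rw [Finset.prod_insert hp, mul_comm (1 + _), mul_assoc]
    refine Eq.trans ?_ ih
    congr 1
    ext d
    rw [add_mul, one_mul, map_add, mul_assoc, PowerSeries.coeff_C_mul]
    cases d with
    | zero =>
      rw [PowerSeries.coeff_zero_X_mul, PowerSeries.coeff_mk, PowerSeries.coeff_mk, hsymmOn_zero,
        hsymmOn_zero, mul_zero, add_zero]
    | succ d =>
      rw [PowerSeries.coeff_succ_X_mul, PowerSeries.coeff_mk, PowerSeries.coeff_mk,
        PowerSeries.coeff_mk, hsymmOn_insert hp, map_add, map_mul, aeval_X]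
      ring

/-- If the letters on A are distinct, ∏(1 - l t) over all letters cancels the denominators of ∑
h_e(A) t^e, leaving k - |A| linear factors. The multiplier is the same for all words. -/
theorem hsymmOn_mem_reducible {ι : Type*} {y : ι → Fin n → Fin k} {A : Finset (Fin n)}
    (hA : ∀ z, Set.InjOn (y z) A) {d : ℕ} (hd : k + 1 ≤ d + A.card) :
    hsymmOn ℚ A d ∈ reducible (evalPoints fun z => wordPoint (y z)) {b | b.degree < d} := by
  classical
  refine mem_reducible_of_series (u := hsymmOn ℚ A) (isHomogeneous_hsymmOn A)
    (c := ∏ l : Fin k, (1 + PowerSeries.C (-((l : ℕ) : ℚ)) * PowerSeries.X))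
    (constantCoeff_prod_one_add _ _) fun z => ?_
  have h1 : ∏ l ∈ A.image (y z), (1 + PowerSeries.C (-((l : ℕ) : ℚ)) * PowerSeries.X) =
      ∏ p ∈ A, (1 + PowerSeries.C (-wordPoint (y z) p) * PowerSeries.X) :=
    Finset.prod_image (hA z)
  rw [← Finset.prod_mul_prod_compl (A.image (y z)), h1, mul_right_comm, prod_one_sub_mul_series,
    one_mul]
  apply coeff_prod_one_add_eq_zero
  have h2 := Finset.card_le_univ (A.image (y z))
  rw [Finset.card_image_of_injOn (hA z), Fintype.card_fin] at h2
  rw [Finset.card_compl, Fintype.card_fin, Finset.card_image_of_injOn (hA z)]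
  omega

/-- If the word uses all letters, ∏(1 + y_p t) is divisible by ∏(1 + l t) over all letters, and the
quotient has n - k linear factors, one for each position outside a chosen section of the word. -/
theorem esymm_mem_reducible {ι : Type*} {y : ι → Fin n → Fin k}
    (hy : ∀ z, Function.Surjective (y z)) {d : ℕ} (hd : n + 1 ≤ d + k) :
    esymm (Fin n) ℚ d ∈ reducible (evalPoints fun z => wordPoint (y z)) {b | b.degree < d} := by
  classical
  set E : PowerSeries ℚ := ∏ l : Fin k, (1 + PowerSeries.C ((l : ℕ) : ℚ) * PowerSeries.X) with hE
  have hE1 : PowerSeries.constantCoeff E = 1 := constantCoeff_prod_one_add _ _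
  refine mem_reducible_of_series (u := esymm (Fin n) ℚ) isHomogeneous_esymm (c := E⁻¹)
    (by rw [PowerSeries.constantCoeff_inv, hE1, inv_one]) fun z => ?_
  have h1 : PowerSeries.mk (fun e => aeval (wordPoint (y z)) (esymm (Fin n) ℚ e)) =
      ∏ p, (1 + PowerSeries.C (wordPoint (y z) p) * PowerSeries.X) := by
    ext e
    rw [PowerSeries.coeff_mk, coeff_prod_one_add_C_mul_X, esymm, map_sum]
    simp only [map_prod, aeval_X]
  set g := Function.surjInv (hy z) with hg
  have hgi : Function.Injective g := Function.injective_surjInv (hy z)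
  have h2 : ∏ p ∈ Finset.univ.image g, (1 + PowerSeries.C (wordPoint (y z) p) * PowerSeries.X) =
      E := by
    rw [Finset.prod_image hgi.injOn]
    refine Finset.prod_congr rfl fun l _ => ?_
    rw [wordPoint, Function.surjInv_eq (hy z) l]
  rw [h1, ← Finset.prod_mul_prod_compl (Finset.univ.image g), h2, ← mul_assoc,
    PowerSeries.inv_mul_cancel _ (by rw [hE1]; exact one_ne_zero), one_mul]
  apply coeff_prod_one_add_eq_zero
  have h3 := Finset.card_le_univ (Finset.univ.image g)
  rw [Finset.card_image_of_injective _ hgi, Finset.card_univ, Fintype.card_fin,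
    Fintype.card_fin] at h3
  rw [Finset.card_compl, Finset.card_image_of_injective _ hgi, Finset.card_univ, Fintype.card_fin,
    Fintype.card_fin]
  omega

theorem card_batchInit (hn : ∑ i, α i = n) (i : Fin r) : (batchInit n α i (α i)).card = α i := by
  have hle := batchStart_add_le (α := α) i
  have : (batchInit n α i (α i)).card =
      (Finset.Ico (batchStart α i) (batchStart α i + α i)).card := by
    refine Finset.card_bij (fun p _ => (p : ℕ)) (fun p hp => ?_) (fun _ _ _ _ h => Fin.ext h)
      fun q hq => ?_
    · rw [mem_batchInit] at hp
      exact Finset.mem_Ico.2 hp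
    · have hq' := Finset.mem_Ico.1 hq
      exact ⟨⟨q, by omega⟩, mem_batchInit.2 hq', rfl⟩
  rw [this, Nat.card_Ico, Nat.add_sub_cancel_left]

/-- The words that use all letters and repeat no letter in a batch. -/
def ConfigWord (n k : ℕ) (α : Fin r → ℕ) : Type :=
  {y : Fin n → Fin k // Function.Surjective y ∧ ∀ i, Set.InjOn y (batchInit n α i (α i))}

instance : Finite (ConfigWord n k α) := Subtype.finite

theorem exists_injective_configWord (hk : 0 < k) (hkn : k ≤ n + 1) (hα : ∀ i, α i ≤ k)
    (hn : ∑ i, α i = n) :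
    ∃ φ : {b : Fin n →₀ ℕ // ∀ a ∈ (neglex n).degree '' groebnerSet ℚ n α k, ¬ a ≤ b} →
      ConfigWord n k α, Function.Injective φ := by
  choose i hi using exists_mem_batch hn
  let s : ℕ → ℕ := fun p => if h : p < n then batchStart α (i ⟨p, h⟩) else 0
  have hs : ∀ p : Fin n, s p = batchStart α (i p) := fun p => dif_pos p.2
  obtain ⟨w, hw⟩ := exists_words (n := n) hk hkn s
  have hbox : ∀ b : Fin n →₀ ℕ, (∀ a ∈ (neglex n).degree '' groebnerSet ℚ n α k, ¬ a ≤ b) →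
      ∀ p : Fin n, b p + (p - s p) < k := by
    intro b hb p
    obtain ⟨h1, h2⟩ := hi p
    obtain ⟨j, hj⟩ := Nat.exists_eq_add_of_le h1
    -- With j counted from zero, the basis element for j + 1 has leading monomial x_p^{k-j}, so
    -- nondivisibility is exactly the box condition of `exists_words`.
    have h3 := hb _ ⟨_, Or.inr ⟨i p, j + 1, by omega, by omega, rfl⟩, rfl⟩
    rw [(hasLead_hsymmOn_batchInit ℚ hj _).degree_eq, Finsupp.single_le_iff] at h3
    have := hα (i p)
    rw [hs]
    omega
  have hskip : ∀ b : Fin n →₀ ℕ, (∀ a ∈ (neglex n).degree '' groebnerSet ℚ n α k, ¬ a ≤ b) →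
      ∀ T : Finset (Fin n), T.card + k = n + 1 → ∃ t ∈ T, b t < gapSeq T t := by
    intro b hb T hT
    have hS : (T.map Fin.revPerm.toEmbedding).card + k = n + 1 := by rwa [Finset.card_map]
    have h1 := hb _ ⟨_, Or.inl ⟨_, hS, rfl⟩, rfl⟩
    have hTT : (T.map Fin.revPerm.toEmbedding).map Fin.revPerm.toEmbedding = T := by
      ext p
      simp
    rw [(demazure_revSkipSeq ℚ hk _ hS).2.degree_eq, revSkipSeq_eq_gapSeq, hTT, Finsupp.le_def] at h1
    push Not at h1
    obtain ⟨t, ht⟩ := h1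
    rw [Finsupp.equivFunOnFinite_symm_apply_apply] at ht
    refine ⟨t, ?_, ht⟩
    by_contra htT
    rw [gapSeq, if_neg htT] at ht
    exact Nat.not_lt_zero _ ht
  have hinj : ∀ b : Fin n →₀ ℕ, (∀ a ∈ (neglex n).degree '' groebnerSet ℚ n α k, ¬ a ≤ b) →
      ∀ j, Set.InjOn (w b) (batchInit n α j (α j)) := by
    intro b hb j
    have key : ∀ q p : Fin n, q ∈ batchInit n α j (α j) → p ∈ batchInit n α j (α j) → q < p →
        w b q ≠ w b p := by
      intro q p hq hp hqp
      rw [mem_batchInit] at hq hp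
      have hij : i p = j := by
        have h1 := hi p
        rcases lt_trichotomy (i p) j with h | h | h
        · have := batchStart_add_le_of_lt (α := α) h
          omega
        · exact h
        · have := batchStart_add_le_of_lt (α := α) h
          omega
      refine (hw b (hbox b hb)).1 q p hqp ?_
      rw [hs, hij]
      exact hq.1
    intro q hq p hp e
    rcases lt_trichotomy q p with h | h | h
    · exact absurd e (key q p hq hp h)
    · exact h
    · exact absurd e.symm (key p q hp hq h)
  refine ⟨fun b => ⟨w b.1, (hw b.1 (hbox b.1 b.2)).2.2 (hskip b.1 b.2), hinj b.1 b.2⟩, ?_⟩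
  intro b b' h
  exact Subtype.ext ((hw b.1 (hbox b.1 b.2)).2.1 b'.1 (hbox b'.1 b'.2) (congrArg Subtype.val h))

theorem exists_degree_le_of_mem_configIdeal (hk : 0 < k) (hkn : k ≤ n + 1) (hα : ∀ i, α i ≤ k)
    (hn : ∑ i, α i = n) {f : MvPolynomial (Fin n) ℚ} (hf : f ∈ configIdeal ℚ n α k) (hf0 : f ≠ 0) :
    ∃ g ∈ groebnerSet ℚ n α k, (neglex n).degree g ≤ (neglex n).degree f := by
  have := Fintype.ofFinite (ConfigWord n k α)
  let pt : ConfigWord n k α → Fin n → ℚ := fun y => wordPoint y.1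
  have hpt : Function.Injective pt := wordPoint_injective.comp Subtype.val_injective
  -- Surjectivity of the words handles the elementary generators, injectivity on batches the
  -- complete homogeneous ones. Membership of the candidate basis in the ideal then transfers the
  -- reduction to its leading monomials.
  have hred : ∀ f ∈ configIdeal ℚ n α k, f ≠ 0 → monomial ((neglex n).degree f) 1 ∈
      reducible (evalPoints pt)
        {b | gradedRank (neglex n) b < gradedRank (neglex n) ((neglex n).degree f)} := by
    intro f hf hf0
    refine leadingMonomial_mem_reducible _ hf0 (homogeneousComponent_mem_reducible ?_ hf)
    rintro g (⟨d, h1, -, rfl⟩ | ⟨i, d, h1, -, rfl⟩)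
    · exact ⟨d, isHomogeneous_esymm d, esymm_mem_reducible (fun y => y.2.1) h1⟩
    · refine ⟨d, isHomogeneous_hsymmOn _ d, hsymmOn_mem_reducible (fun y => y.2.2 i) ?_⟩
      rw [card_batchInit hn]
      exact h1
  obtain ⟨φ, hφ⟩ := exists_injective_configWord hk hkn hα hn
  have hG : ∀ a ∈ (neglex n).degree '' groebnerSet ℚ n α k, monomial a 1 ∈
      reducible (evalPoints pt) {b | gradedRank (neglex n) b < gradedRank (neglex n) a} := by
    rintro a ⟨g, hg, rfl⟩
    obtain ⟨μ, hμ⟩ := groebnerSet_hasLead ℚ hk hn hg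
    refine hred g (groebnerSet_subset ℚ hk hα hn hg) ?_
    rintro rfl
    exact zero_ne_one hμ.1
  obtain ⟨a, ⟨g, hg, rfl⟩, hle⟩ := exists_le_of_monomial_mem_reducible (neglex n)
    (evalPoints_surjective hpt) hG φ hφ (hred f hf hf0)
  exact ⟨g, hg, hle⟩

theorem initialIdeal_configIdeal (hk : 0 < k) (hkn : k ≤ n + 1) (hα : ∀ i, α i ≤ k)
    (hn : ∑ i, α i = n) :
    initialIdeal (neglex n) (configIdeal ℚ n α k : Set (MvPolynomial (Fin n) ℚ)) =
      initialIdeal (neglex n) (groebnerSet ℚ n α k) := by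
  apply le_antisymm
  · refine Ideal.span_le.2 ?_
    rintro p ⟨f, hf, hf0, rfl⟩
    obtain ⟨g, hg, hle⟩ := exists_degree_le_of_mem_configIdeal hk hkn hα hn hf hf0
    obtain ⟨c, hc⟩ := exists_add_of_le hle
    obtain ⟨μ, hμ⟩ := groebnerSet_hasLead ℚ hk hn hg
    have hg0 : g ≠ 0 := by
      rintro rfl
      exact zero_ne_one hμ.1
    have e : initialMonomial (neglex n) f = monomial c 1 * initialMonomial (neglex n) g := by
      rw [initialMonomial, initialMonomial, monomial_mul, hc, add_comm, one_mul]
    rw [SetLike.mem_coe, e]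
    exact Ideal.mul_mem_left _ _ (Ideal.subset_span ⟨g, hg, hg0, rfl⟩)
  · refine Ideal.span_mono ?_
    rintro p ⟨g, hg, hg0, rfl⟩
    exact ⟨g, groebnerSet_subset ℚ hk hα hn hg, hg0, rfl⟩

end ConfigPoints

end SpanningConfig

end

theorem mainTheorem4 {r : ℕ} (n k : ℕ) (hk : 0 < k) (hkn : k ≤ n + 1) (α : Fin r → ℕ)
    (hα : ∀ i, 1 ≤ α i ∧ α i ≤ k) (hn : ∑ i, α i = n) :
    SpanningConfig.IsGroebnerBasis (SpanningConfig.neglex n)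
        (SpanningConfig.configIdeal ℚ n α k) (SpanningConfig.groebnerSet ℚ n α k) ∧
      ∀ g ∈ SpanningConfig.groebnerSet ℚ n α k,
        (SpanningConfig.neglex n).leadingCoeff g = 1 ∧
          ∃ f : MvPolynomial (Fin n) ℤ,
            MvPolynomial.map (Int.castRingHom ℚ) f = g ∧
              f ∈ SpanningConfig.configIdeal ℤ n α k := by
  have hα' : ∀ i, α i ≤ k := fun i => (hα i).2
  refine ⟨⟨SpanningConfig.groebnerSet_finite ℚ, SpanningConfig.groebnerSet_subset ℚ hk hα' hn,
    SpanningConfig.initialIdeal_configIdeal hk hkn hα' hn⟩, fun g hg => ⟨?_, ?_⟩⟩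
  · obtain ⟨μ, hμ⟩ := SpanningConfig.groebnerSet_hasLead ℚ hk hn hg
    exact hμ.leadingCoeff_eq
  · exact SpanningConfig.exists_map_eq_of_mem_groebnerSet hk hα' hn hg
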